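/- Let $X$ be a finite set. A root datum of $X$ is a quadruple $v=(\mathfrak h,a,b,p)$ where $\mathfrak h$ is a finite-dimensional complex vector space, $a:X\to\mathfrak h$ and $b:X\to\mathfrak h^*$ are linearly independent families and $p:X\to\mathbb Z/2$; put $a_{xy}=\langle a(x),b(y)\rangle$. The $b(x)$ are the simple roots at $v$, and $Q_v^+=\sum_{x\in X}\mathbb Z_{\ge0}\,b(x)$. An element $x\in X$ is reflectable at $v$ if either $a_{xx}=0$ and $p(x)=1$ (isotropic case), or $a_{xx}\neq0$, $p(x)=0$ and $2a_{xy}/a_{xx}\in\mathbb Z_{\le0}$ for all $y\ne x$, or $a_{xx}\ne0$, $p(x)=1$ and $a_{xy}/a_{xx}\in\mathbb Z_{\le0}$ for all $y\neq x$ (anisotropic cases). If $x$ is reflectable, the reflexion $r_x:v\to v'=(\mathfrak h,a',b',p')$ is given as follows. In the anisotropic cases $a'(y)=a(y)-2\frac{a_{yx}}{a_{xx}}a(x)$, $b'(y)=b(y)-2\frac{a_{xy}}{a_{xx}}b(x)$, $p'=p$. In the isotropic case $(a'(y),b'(y),p'(y))$ equals $(-a(x),-b(x),p(x))$ if $y=x$;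 $(a(y),b(y),p(y))$ if $y\ne x$ and $a_{xy}=0$; and $(a(y)+\frac{a_{yx}}{a_{xy}}a(x),\,b(y)+b(x),\,p(y)+1)$ if $y\neq x$ and $a_{xy}\ne0$. The root groupoid has the root data of $X$ as objects; its arrows are the linear isomorphisms $\mathfrak h(v)\to\mathfrak h(v')$ induced by compositions of reflexions (inducing $\mathrm{id}_{\mathfrak h}$), homotheties $a(x)\mapsto\lambda(x)a(x)$ with $\lambda:X\to\mathbb C^*$ (inducing $\mathrm{id}_{\mathfrak h}$), and transports of structure along isomorphisms $\theta:\mathfrak h\to\mathfrak h'$ (inducing $\theta$). The skeleton $\mathrm{Sk}(v)$ (resp. the spine $\mathrm{Sp}(v)$) consists of the root data obtained from $v$ by chains of reflexions (resp. of isotropic reflexions). For a root datum $v$ let $\tilde{\mathfrak g}(v)$ be the Lie superalgebra generated by the even commutative space $\mathfrak h$ and elements $\tilde e_{\pm b(x)}$ ($x\in X$) of parity $p(x)$, with relations $[h,\tilde e_{\pm b(x)}]=\pm\langle h,b(x)\rangle\tilde e_{\pm b(x)}$ and $[\tilde e_{b(x)},\tilde e_{-b(y)}]=\delta_{xy}a(x)$.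 A connected component of the root groupoid is admissible if there are quotients $\mathfrak g(v)$ of $\tilde{\mathfrak g}(v)$, for all $v$ in the component, in which $\mathfrak h(v)$ embeds, such that for each arrow $v\to v'$ of the component the isomorphism $\mathfrak h(v)\to\mathfrak h(v')$ extends to an isomorphism of Lie superalgebras $\mathfrak g(v)\to\mathfrak g(v')$. Let $v$ be a vertex of an admissible component. Let $\Delta_{\mathrm{an}}$ be the set of all $b_u(x)$ with $u\in\mathrm{Sk}(v)$, $x$ reflectable at $u$ and $\langle a_u(x),b_u(x)\rangle\neq0$, and let $\Delta_{\mathrm{an}}^+=\Delta_{\mathrm{an}}\cap Q_v^+$. A principal root is an element of $\Delta_{\mathrm{an}}$ which equals $b_u(x)$ for some $u\in\mathrm{Sp}(v)$ and $x\in X$. An element of $\Delta_{\mathrm{an}}^+$ is called indecomposable if it is not the sum of a finite family of two or more (not necessarily distinct) elements of $\Delta_{\mathrm{an}}^+$. Proposition. The set of principal roots coincides with the set of indecomposable elements of $\Delta_{\mathrm{an}}^+$. -/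

import Mathlib

universe u w

/-- Adding multiples of one member `f x` of a linearly independent family to all members keeps the
family independent, provided the coefficient of `f x` itself does not become zero. -/
theorem LinearIndependent.add_smul_member {X : Type w} {V : Type u} [AddCommGroup V] [Module ℂ V]
    {f : X → V} (hf : LinearIndependent ℂ f) (x : X) (c : X → ℂ) (hc : 1 + c x ≠ 0) :
    LinearIndependent ℂ (fun y => f y + c y • f x) := by
  rw [linearIndependent_iff] at hf ⊢
  intro l hl
  have key : Finsupp.linearCombination ℂ f
      (l + Finsupp.single x (Finsupp.linearCombination ℂ c l)) = 0 := by
    rw [← hl, map_add, Finsupp.linearCombination_single]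
    simp only [Finsupp.linearCombination_apply, Finsupp.sum, smul_add, Finset.sum_add_distrib,
      Finset.sum_smul, smul_smul, smul_eq_mul]
  have h0 := hf _ key
  have hl' : l = Finsupp.single x (-(Finsupp.linearCombination ℂ c l)) := by
    rw [Finsupp.single_neg]
    exact eq_neg_of_add_eq_zero_left h0
  have hS : Finsupp.linearCombination ℂ c l = 0 := by
    have h1 : Finsupp.linearCombination ℂ c l = -(Finsupp.linearCombination ℂ c l) * c x := by
      conv_lhs => rw [hl']
      rw [Finsupp.linearCombination_single, smul_eq_mul]
    have h2 : Finsupp.linearCombination ℂ c l * (1 + c x) = 0 := by linear_combination h1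
    exact (mul_eq_zero.mp h2).resolve_right hc
  rw [hl', hS]
  simp

/-- A root datum `(𝔥, a, b, p)` indexed by `X`, with underlying complex vector space `𝔥`. -/
@[ext]
structure SuperRootDatum (X : Type w) (𝔥 : Type u) [AddCommGroup 𝔥] [Module ℂ 𝔥] where
  a : X → 𝔥
  b : X → Module.Dual ℂ 𝔥
  p : X → ZMod 2
  linearIndependent_a : LinearIndependent ℂ a
  linearIndependent_b : LinearIndependent ℂ b

namespace SuperRootDatum

section Basic

variable {X : Type w} {𝔥 : Type u} [AddCommGroup 𝔥] [Module ℂ 𝔥]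

/-- The Cartan matrix `a_{xy} = ⟨a(x), b(y)⟩`. -/
def cartan (v : SuperRootDatum X 𝔥) (x y : X) : ℂ := v.b y (v.a x)

/-- `x` is reflectable at `v`. -/
def Reflectable (v : SuperRootDatum X 𝔥) (x : X) : Prop :=
  (v.cartan x x = 0 ∧ v.p x = 1) ∨
  (v.cartan x x ≠ 0 ∧ v.p x = 0 ∧
    ∀ y, y ≠ x → ∃ n : ℕ, 2 * v.cartan x y / v.cartan x x = -(n : ℂ)) ∨
  (v.cartan x x ≠ 0 ∧ v.p x = 1 ∧
    ∀ y, y ≠ x → ∃ n : ℕ, v.cartan x y / v.cartan x x = -(n : ℂ))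

/-- The target of the anisotropic reflexion `r_x` (used when `a_{xx} ≠ 0`). -/
noncomputable def anisotropicReflexion (v : SuperRootDatum X 𝔥) (x : X) (hx : v.cartan x x ≠ 0) :
    SuperRootDatum X 𝔥 where
  a y := v.a y - (2 * v.cartan y x / v.cartan x x) • v.a x
  b y := v.b y - (2 * v.cartan x y / v.cartan x x) • v.b x
  p := v.p
  linearIndependent_a := by
    have h := v.linearIndependent_a.add_smul_member x
      (fun y => -(2 * v.cartan y x / v.cartan x x)) (by field_simp; norm_num)
    simpa only [neg_smul, ← sub_eq_add_neg] using h
  linearIndependent_b := by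
    have h := v.linearIndependent_b.add_smul_member x
      (fun y => -(2 * v.cartan x y / v.cartan x x)) (by field_simp; norm_num)
    simpa only [neg_smul, ← sub_eq_add_neg] using h

open Classical in
/-- The target of the isotropic reflexion `r_x` (used when `a_{xx} = 0` and `p(x) = 1`). -/
noncomputable def isotropicReflexion (v : SuperRootDatum X 𝔥) (x : X) : SuperRootDatum X 𝔥 where
  a y := if y = x then -v.a x else if v.cartan x y = 0 then v.a y
    else v.a y + (v.cartan y x / v.cartan x y) • v.a x
  b y := if y = x then -v.b x else if v.cartan x y = 0 then v.b y else v.b y + v.b x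
  p y := if y = x then v.p x else if v.cartan x y = 0 then v.p y else v.p y + 1
  linearIndependent_a := by
    have h := v.linearIndependent_a.add_smul_member x
      (fun y => if y = x then -2 else if v.cartan x y = 0 then 0
        else v.cartan y x / v.cartan x y) (by norm_num)
    convert h using 2 with y
    split_ifs with h1 h2
    · subst h1; module
    · simp
    · rfl
  linearIndependent_b := by
    have e : (fun y => if y = x then -v.b x else if v.cartan x y = 0 then v.b y
        else v.b y + v.b x) = fun y => v.b y +
          (if y = x then (-2 : ℂ) else if v.cartan x y = 0 then 0 else 1) • v.b x := by
      funext y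
      split_ifs with h1 h2
      · subst h1; module
      · simp
      · simp
    rw [e]
    exact v.linearIndependent_b.add_smul_member x
      (fun y => if y = x then -2 else if v.cartan x y = 0 then 0 else 1) (by norm_num)

/-- `u` is obtained from `v` by the isotropic reflexion `r_x`. -/
def IsIsotropicReflexion (v : SuperRootDatum X 𝔥) (x : X) (u : SuperRootDatum X 𝔥) : Prop :=
  v.Reflectable x ∧ v.cartan x x = 0 ∧ u = v.isotropicReflexion x

/-- `u` is obtained from `v` by the anisotropic reflexion `r_x`. -/
def IsAnisotropicReflexion (v : SuperRootDatum X 𝔥) (x : X) (u : SuperRootDatum X 𝔥) : Prop :=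
  v.Reflectable x ∧ ∃ hx : v.cartan x x ≠ 0, u = v.anisotropicReflexion x hx

/-- `u` is obtained from `v` by the reflexion `r_x`. -/
def IsReflexion (v : SuperRootDatum X 𝔥) (x : X) (u : SuperRootDatum X 𝔥) : Prop :=
  v.IsIsotropicReflexion x u ∨ v.IsAnisotropicReflexion x u

/-- The vertices of the skeleton `Sk(v)`: root data reached from `v` by chains of reflexions.
(Reflexions are involutive, so this is the connected component.) -/
def skeleton (v : SuperRootDatum X 𝔥) : Set (SuperRootDatum X 𝔥) :=
  {u | Relation.ReflTransGen (fun v₁ v₂ => ∃ x, v₁.IsReflexion x v₂) v u}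

/-- The vertices of the spine `Sp(v)`: root data reached from `v` by chains of isotropic
reflexions. -/
def spine (v : SuperRootDatum X 𝔥) : Set (SuperRootDatum X 𝔥) :=
  {u | Relation.ReflTransGen (fun v₁ v₂ => ∃ x, v₁.IsIsotropicReflexion x v₂) v u}

/-- The set `Δ_an` of anisotropic real roots: the simple roots `b_u(x)`, `u ∈ Sk(v)`, with `x`
reflectable at `u` and `⟨a_u(x), b_u(x)⟩ ≠ 0`. -/
def anisotropicRoots (v : SuperRootDatum X 𝔥) : Set (Module.Dual ℂ 𝔥) :=
  {α | ∃ u ∈ v.skeleton, ∃ x, u.Reflectable x ∧ u.cartan x x ≠ 0 ∧ α = u.b x}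

/-- `Q_v^+`, the non-negative integral linear combinations of the simple roots at `v`. -/
def positiveCone (v : SuperRootDatum X 𝔥) : AddSubmonoid (Module.Dual ℂ 𝔥) :=
  AddSubmonoid.closure (Set.range v.b)

/-- `Δ_an^+ = Δ_an ∩ Q_v^+`. -/
def positiveAnisotropicRoots (v : SuperRootDatum X 𝔥) : Set (Module.Dual ℂ 𝔥) :=
  v.anisotropicRoots ∩ v.positiveCone

/-- The set `Σ_pr` of principal roots: the anisotropic real roots which are simple roots at some
vertex of the spine. -/
def principalRoots (v : SuperRootDatum X 𝔥) : Set (Module.Dual ℂ 𝔥) :=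
  {α | α ∈ v.anisotropicRoots ∧ ∃ u ∈ v.spine, ∃ x, α = u.b x}

/-- The target of the homothety arrow `h_c`. -/
def homothety (v : SuperRootDatum X 𝔥) (c : X → ℂˣ) : SuperRootDatum X 𝔥 where
  a x := c x • v.a x
  b := v.b
  p := v.p
  linearIndependent_a := v.linearIndependent_a.units_smul c
  linearIndependent_b := v.linearIndependent_b

/-- The target of the tautological arrow `t_θ`. -/
def transport {𝔥' : Type u} [AddCommGroup 𝔥'] [Module ℂ 𝔥'] (v : SuperRootDatum X 𝔥)
    (θ : 𝔥 ≃ₗ[ℂ] 𝔥') : SuperRootDatum X 𝔥' where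
  a x := θ (v.a x)
  b x := θ.symm.dualMap (v.b x)
  p := v.p
  linearIndependent_a := v.linearIndependent_a.map' θ.toLinearMap θ.ker
  linearIndependent_b :=
    v.linearIndependent_b.map' θ.symm.dualMap.toLinearMap θ.symm.dualMap.ker

end Basic

/-- Arrows of the root groupoid. An arrow `v → v'` is a class of compositions of generators
(reflexions, homotheties, tautological arrows), two compositions being identified when they induce
the same isomorphism of the underlying spaces; so it is recorded by that isomorphism `θ`. -/
inductive Arrow {X : Type w} : ∀ {V V' : Type u} [AddCommGroup V] [Module ℂ V]
    [AddCommGroup V'] [Module ℂ V'], SuperRootDatum X V → SuperRootDatum X V' → (V ≃ₗ[ℂ] V') → Prop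
  | id {V : Type u} [AddCommGroup V] [Module ℂ V] (v : SuperRootDatum X V) :
      Arrow v v (LinearEquiv.refl ℂ V)
  | reflexion {V : Type u} [AddCommGroup V] [Module ℂ V] (v v' : SuperRootDatum X V) (x : X)
      (h : v.IsReflexion x v') : Arrow v v' (LinearEquiv.refl ℂ V)
  | tautological {V V' : Type u} [AddCommGroup V] [Module ℂ V] [AddCommGroup V'] [Module ℂ V']
      (v : SuperRootDatum X V) (θ : V ≃ₗ[ℂ] V') : Arrow v (v.transport θ) θ
  | homothety {V : Type u} [AddCommGroup V] [Module ℂ V] (v : SuperRootDatum X V) (c : X → ℂˣ) :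
      Arrow v (v.homothety c) (LinearEquiv.refl ℂ V)
  | comp {V V' V'' : Type u} [AddCommGroup V] [Module ℂ V] [AddCommGroup V'] [Module ℂ V']
      [AddCommGroup V''] [Module ℂ V''] {v : SuperRootDatum X V} {v' : SuperRootDatum X V'}
      {v'' : SuperRootDatum X V''} {θ : V ≃ₗ[ℂ] V'} {θ' : V' ≃ₗ[ℂ] V''} :
      Arrow v v' θ → Arrow v' v'' θ' → Arrow v v'' (θ.trans θ')

end SuperRootDatum

/-- A complex Lie superalgebra structure on a vector space `𝔤`. -/
structure LieSuperalgebra (𝔤 : Type u) [AddCommGroup 𝔤] [Module ℂ 𝔤] where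
  part : ZMod 2 → Submodule ℂ 𝔤
  isCompl : IsCompl (part 0) (part 1)
  bracket : 𝔤 →ₗ[ℂ] 𝔤 →ₗ[ℂ] 𝔤
  bracket_mem : ∀ (i j : ZMod 2) (x y : 𝔤), x ∈ part i → y ∈ part j → bracket x y ∈ part (i + j)
  skew : ∀ (i j : ZMod 2) (x y : 𝔤), x ∈ part i → y ∈ part j →
    bracket x y = -((-1 : ℂ) ^ (i * j).val • bracket y x)
  jacobi : ∀ (i j : ZMod 2) (x y z : 𝔤), x ∈ part i → y ∈ part j →
    bracket x (bracket y z) =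
      bracket (bracket x y) z + (-1 : ℂ) ^ (i * j).val • bracket y (bracket x z)

namespace SuperRootDatum

open Classical in
/-- A quotient of the half-baked Lie superalgebra at `v` in which `𝔥` embeds. The half-baked
superalgebra is presented by generators `𝔥`, `e_x`, `f_x` (the elements `ẽ_{b(x)}`, `ẽ_{-b(x)}`),
so its quotients are exactly the Lie superalgebras generated by elements which satisfy the defining
relations. -/
structure HalfBakedQuotient {X : Type w} {𝔥 : Type u} [AddCommGroup 𝔥] [Module ℂ 𝔥]
    (v : SuperRootDatum X 𝔥) where
  carrier : Type (max u w)
  [addCommGroup : AddCommGroup carrier]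
  [module : Module ℂ carrier]
  str : LieSuperalgebra carrier
  ι : 𝔥 →ₗ[ℂ] carrier
  e : X → carrier
  f : X → carrier
  ι_even : ∀ h, ι h ∈ str.part 0
  e_mem : ∀ x, e x ∈ str.part (v.p x)
  f_mem : ∀ x, f x ∈ str.part (v.p x)
  bracket_ι_ι : ∀ h h', str.bracket (ι h) (ι h') = 0
  bracket_ι_e : ∀ h x, str.bracket (ι h) (e x) = v.b x h • e x
  bracket_ι_f : ∀ h x, str.bracket (ι h) (f x) = -(v.b x h • f x)
  bracket_e_f : ∀ x y, str.bracket (e x) (f y) = if x = y then ι (v.a x) else 0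
  generated : ∀ S : Submodule ℂ carrier, (∀ h, ι h ∈ S) → (∀ x, e x ∈ S) → (∀ x, f x ∈ S) →
    (∀ y ∈ S, ∀ z ∈ S, str.bracket y z ∈ S) → S = ⊤
  ι_injective : Function.Injective ι

attribute [instance] HalfBakedQuotient.addCommGroup HalfBakedQuotient.module

/-- The isomorphism `θ : 𝔥(v) → 𝔥(v')` extends to an isomorphism of Lie superalgebras. -/
def HalfBakedQuotient.Extends {X : Type w} {V V' : Type u} [AddCommGroup V] [Module ℂ V]
    [AddCommGroup V'] [Module ℂ V'] {v : SuperRootDatum X V} {v' : SuperRootDatum X V'}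
    (g : HalfBakedQuotient v) (g' : HalfBakedQuotient v') (θ : V ≃ₗ[ℂ] V') : Prop :=
  ∃ φ : g.carrier ≃ₗ[ℂ] g'.carrier,
    (∀ i, ∀ y ∈ g.str.part i, φ y ∈ g'.str.part i) ∧
    (∀ y z, φ (g.str.bracket y z) = g'.str.bracket (φ y) (φ z)) ∧
    ∀ h, φ (g.ι h) = g'.ι (θ h)

/-- A root algebra supported on the connected component of `v` in the root groupoid: quotients
`𝔤(v')` of the half-baked superalgebras, one for each vertex `v'` of the component, such that for
every arrow of the component the isomorphism of the Cartan spaces extends to an isomorphism of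
Lie superalgebras. -/
structure RootAlgebra {X : Type w} {𝔥 : Type u} [AddCommGroup 𝔥] [Module ℂ 𝔥]
    (v : SuperRootDatum X 𝔥) where
  alg : ∀ {V : Type u} [AddCommGroup V] [Module ℂ V] (v' : SuperRootDatum X V),
    (∃ θ, Arrow v v' θ) → HalfBakedQuotient v'
  extends_arrow : ∀ {V V' : Type u} [AddCommGroup V] [Module ℂ V] [AddCommGroup V'] [Module ℂ V']
    (v₁ : SuperRootDatum X V) (v₂ : SuperRootDatum X V') (h₁ : ∃ θ, Arrow v v₁ θ) (h₂ : ∃ θ, Arrow v v₂ θ)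
    (θ : V ≃ₗ[ℂ] V'), Arrow v₁ v₂ θ → (alg v₁ h₁).Extends (alg v₂ h₂) θ

/-- The connected component of `v` is admissible: it admits a root algebra. -/
def Admissible {X : Type w} {𝔥 : Type u} [AddCommGroup 𝔥] [Module ℂ 𝔥]
    (v : SuperRootDatum X 𝔥) : Prop :=
  Nonempty (RootAlgebra v)

end SuperRootDatum

/-- `α` is an indecomposable element of `S`: it lies in `S` and is not the sum of a finite family
of two or more (not necessarily distinct) elements of `S`. -/
def IsIndecomposableIn {M : Type u} [AddCommMonoid M] (S : Set M) (α : M) : Prop :=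
  α ∈ S ∧ ∀ s : Multiset M, 2 ≤ Multiset.card s → (∀ β ∈ s, β ∈ S) → s.sum ≠ α

/-!
The vertices of the skeleton of `v` all carry the same Lie superalgebra with the same Cartan space.
By the triangular decomposition (`wordSpan_sup_range_sup_wordSpan`) its weights are positive or
negative at each vertex, and the root spaces of `± b x` are lines, spanned by the generators. So a
simple root at one vertex is positive or negative at every other one
(`Admissible.b_mem_or_neg_mem`), and a simple root determines its coroot up to a scalar
(`Admissible.exists_a_eq_smul`). A reflexion `r_x` changes the sign of no simple root of the
skeleton other than `± b x`; since an anisotropic root is not `±` an isotropic one, the signs of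
anisotropic real roots are constant along spines (`Admissible.mem_of_mem_spine`).

Hence a principal root `b_u x`, with `u` in the spine of `v`, is positive; it is indecomposable
because every positive anisotropic root has height at least one at `u`, while `b_u x` has height
exactly one.

Conversely, let `α` be indecomposable. It is simple at some vertex `u` of the skeleton, and one
argues by induction on the number of anisotropic reflexions in a chain from `v` to `u`. Anisotropic
reflexions are transports along reflections of the Cartan space, which yields the exchange property
of Coxeter groups (`Admissible.exists_steps_transport`): reflecting a vertex in an anisotropic root
which is positive there and negative at `v` brings it nearer to `v`. Unless a shorter chain exists,
the last anisotropic reflexion exhibits a root `β`, simple on the spine of `u`, which is negative at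
`v`. The pair `α, β` is then reflected in a negative member as long as there is one, and `α` stays
an integral combination of the pair (`Admissible.descent`). Coefficients of opposite sign never
occur, since `α` would then be negative at the vertex where one member is simple and positive where
the other is, contrary to the constancy of signs on a spine (`Admissible.not_mixed_sign`). When both
members are positive, indecomposability forces `α` to be one of them, so `α` is simple at a vertex
nearer to `v`. At distance zero that vertex lies in the spine of `v`.
-/

/-! ### Iterated brackets and weights in Lie superalgebras -/

namespace LieSuperalgebra

variable {𝔤 : Type u} [AddCommGroup 𝔤] [Module ℂ 𝔤] (L : LieSuperalgebra 𝔤)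

/-- For even `x` the Jacobi identity has no signs and needs no homogeneity of `y` and `z`. -/
theorem bracket_bracket_of_even {x : 𝔤} (hx : x ∈ L.part 0) (y z : 𝔤) :
    L.bracket x (L.bracket y z) = L.bracket (L.bracket x y) z + L.bracket y (L.bracket x z) := by
  obtain ⟨y₀, hy₀, y₁, hy₁, rfl⟩ := Submodule.mem_sup.mp
    (L.isCompl.sup_eq_top ▸ Submodule.mem_top : y ∈ L.part 0 ⊔ L.part 1)
  have h₀ := L.jacobi 0 0 x y₀ z hx hy₀
  have h₁ := L.jacobi 0 1 x y₁ z hx hy₁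
  simp only [zero_mul, ZMod.val_zero, pow_zero, one_smul] at h₀ h₁
  simp only [map_add, LinearMap.add_apply, h₀, h₁]
  abel

/-- A subspace stable under bracketing with a generating set of homogeneous elements is an
ideal. -/
theorem bracket_mem_of_generated {G : Set 𝔤} (hG : ∀ x ∈ G, ∃ i, x ∈ L.part i)
    (gen : ∀ T : Submodule ℂ 𝔤, G ⊆ T → (∀ y ∈ T, ∀ z ∈ T, L.bracket y z ∈ T) → T = ⊤)
    {S : Submodule ℂ 𝔤} (hS : ∀ x ∈ G, ∀ z ∈ S, L.bracket x z ∈ S) (y : 𝔤) {z : 𝔤} (hz : z ∈ S) :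
    L.bracket y z ∈ S := by
  -- The normaliser of `S` is a submodule, but the Jacobi identity is available for homogeneous
  -- elements only; so the subspace spanned by the homogeneous normalising elements is used.
  let H : Set 𝔤 := {x | (∃ i, x ∈ L.part i) ∧ ∀ z ∈ S, L.bracket x z ∈ S}
  have hspan : ∀ x ∈ Submodule.span ℂ H, ∀ z ∈ S, L.bracket x z ∈ S := by
    intro x hx z hz
    induction hx using Submodule.span_induction with
    | mem x hx => exact hx.2 z hz
    | zero => simp
    | add x y _ _ hx hy => simpa using S.add_mem hx hy
    | smul c x _ hx => simpa using S.smul_mem c hx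
  have htop : Submodule.span ℂ H = ⊤ := by
    refine gen _ (fun x hx => Submodule.subset_span ⟨hG x hx, hS x hx⟩) fun x hx y hy => ?_
    induction hx, hy using Submodule.span_induction₂ with
    | mem_mem x y hx hy =>
      obtain ⟨⟨i, hi⟩, hx⟩ := hx
      obtain ⟨⟨j, hj⟩, hy⟩ := hy
      refine Submodule.subset_span ⟨⟨i + j, L.bracket_mem i j x y hi hj⟩, fun z hz => ?_⟩
      rw [eq_sub_of_add_eq (L.jacobi i j x y z hi hj).symm]
      exact S.sub_mem (hx _ (hy _ hz)) (S.smul_mem _ (hy _ (hx _ hz)))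
    | zero_left => simp
    | zero_right => simp
    | add_left x y z _ _ _ h₁ h₂ => simpa using Submodule.add_mem _ h₁ h₂
    | add_right x y z _ _ _ h₁ h₂ => simpa using Submodule.add_mem _ h₁ h₂
    | smul_left c x y _ _ h => simpa using Submodule.smul_mem _ c h
    | smul_right c x y _ _ h => simpa using Submodule.smul_mem _ c h
  exact hspan y (htop ▸ Submodule.mem_top) z hz

section Words

variable {X : Type w} {𝔥 : Type*} [AddCommGroup 𝔥] [Module ℂ 𝔥] {ι : 𝔥 →ₗ[ℂ] 𝔤} {e f : X → 𝔤}

/-- The iterated bracket `[e y₁, [e y₂, …, [e yₖ, e x]]]`; here `l = [y₁, …, yₖ]`. -/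
def word (e : X → 𝔤) (x : X) (l : List X) : 𝔤 := l.foldr (fun y z => L.bracket (e y) z) (e x)

/-- The span of all iterated brackets of the `e x`. -/
def wordSpan (e : X → 𝔤) : Submodule ℂ 𝔤 :=
  Submodule.span ℂ (Set.range fun q : X × List X => L.word e q.1 q.2)

theorem word_mem_wordSpan (e : X → 𝔤) (x : X) (l : List X) : L.word e x l ∈ L.wordSpan e :=
  Submodule.subset_span ⟨(x, l), rfl⟩

theorem bracket_word {β : X → Module.Dual ℂ 𝔥} (hι : ∀ h, ι h ∈ L.part 0)
    (he : ∀ h x, L.bracket (ι h) (e x) = β x h • e x) (h : 𝔥) (x : X) (l : List X) :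
    L.bracket (ι h) (L.word e x l) = (β x + (l.map β).sum) h • L.word e x l := by
  induction l with
  | nil => simpa [word] using he h x
  | cons y l ih =>
    have : L.word e x (y :: l) = L.bracket (e y) (L.word e x l) := rfl
    rw [this, L.bracket_bracket_of_even (hι h), he, ih]
    simp only [map_smul, LinearMap.smul_apply, List.map_cons, List.sum_cons, LinearMap.add_apply,
      ← add_smul]
    congr 1
    ring

theorem bracket_generator_mem_wordSpan (y : X) {z : 𝔤} (hz : z ∈ L.wordSpan e) :
    L.bracket (e y) z ∈ L.wordSpan e := by
  induction hz using Submodule.span_induction with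
  | mem z hz => obtain ⟨q, rfl⟩ := hz; exact L.word_mem_wordSpan e q.1 (y :: q.2)
  | zero => simp
  | add a b _ _ ha hb => simpa using Submodule.add_mem _ ha hb
  | smul c a _ ha => simpa using Submodule.smul_mem _ c ha

theorem bracket_cartan_mem_wordSpan {β : X → Module.Dual ℂ 𝔥} (hι : ∀ h, ι h ∈ L.part 0)
    (he : ∀ h x, L.bracket (ι h) (e x) = β x h • e x) (h : 𝔥) {z : 𝔤} (hz : z ∈ L.wordSpan e) :
    L.bracket (ι h) z ∈ L.wordSpan e := by
  induction hz using Submodule.span_induction with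
  | mem z hz =>
    obtain ⟨q, rfl⟩ := hz
    simp only [L.bracket_word hι he]
    exact Submodule.smul_mem _ _ (L.word_mem_wordSpan e q.1 q.2)
  | zero => simp
  | add a b _ _ ha hb => simpa using Submodule.add_mem _ ha hb
  | smul c a _ ha => simpa using Submodule.smul_mem _ c ha

/-- Bracketing with `f y` removes the letter `y` from a word in the `e x`, at the cost of Cartan
elements. -/
theorem bracket_opposite_mem {β : X → Module.Dual ℂ 𝔥} (hι : ∀ h, ι h ∈ L.part 0)
    {p : X → ZMod 2} (hfp : ∀ x, f x ∈ L.part (p x)) (hep : ∀ x, e x ∈ L.part (p x))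
    (he : ∀ h x, L.bracket (ι h) (e x) = β x h • e x)
    (hfe : ∀ x y, L.bracket (f x) (e y) ∈ LinearMap.range ι) (y : X) {z : 𝔤}
    (hz : z ∈ L.wordSpan e) : L.bracket (f y) z ∈ L.wordSpan e ⊔ LinearMap.range ι := by
  induction hz using Submodule.span_induction with
  | mem z hz =>
    obtain ⟨⟨x, l⟩, rfl⟩ := hz
    simp only
    induction l with
    | nil => exact Submodule.mem_sup_right (hfe y x)
    | cons t l ih =>
      have : L.word e x (t :: l) = L.bracket (e t) (L.word e x l) := rfl
      rw [this, L.jacobi _ _ _ _ _ (hfp y) (hep t)]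
      obtain ⟨h, hh⟩ := hfe y t
      refine Submodule.add_mem _ (Submodule.mem_sup_left ?_)
        (Submodule.smul_mem _ _ (Submodule.mem_sup_left ?_))
      · rw [← hh]
        exact L.bracket_cartan_mem_wordSpan hι he h (L.word_mem_wordSpan e x l)
      · obtain ⟨m, hm, _, ⟨k, rfl⟩, hsum⟩ := Submodule.mem_sup.mp ih
        rw [← hsum, map_add, L.skew _ _ _ _ (hep t) (hι k), he]
        exact Submodule.add_mem _ (L.bracket_generator_mem_wordSpan t hm)
          (Submodule.neg_mem _ (Submodule.smul_mem _ _ (Submodule.smul_mem _ _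
            (L.word_mem_wordSpan e t []))))
  | zero => simp
  | add a b _ _ ha hb => simpa using Submodule.add_mem _ ha hb
  | smul c a _ ha => simpa using Submodule.smul_mem _ c ha

end Words

section Weights

variable {𝔥 : Type*} [AddCommGroup 𝔥] [Module ℂ 𝔥]

/-- `z` has weight `μ` with respect to the map `ι` from the Cartan space. Zero has every weight. -/
def HasWeight (ι : 𝔥 →ₗ[ℂ] 𝔤) (μ : Module.Dual ℂ 𝔥) (z : 𝔤) : Prop :=
  ∀ h, L.bracket (ι h) z = μ h • z

/-- The space of vectors of weight `χ`, as a simultaneous eigenspace. -/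
def weightSpace (ι : 𝔥 →ₗ[ℂ] 𝔤) (χ : 𝔥 → ℂ) : Submodule ℂ 𝔤 :=
  ⨅ h, Module.End.eigenspace (L.bracket (ι h)) (χ h)

variable {L} in
theorem mem_weightSpace {ι : 𝔥 →ₗ[ℂ] 𝔤} {μ : Module.Dual ℂ 𝔥} {z : 𝔤} :
    z ∈ L.weightSpace ι μ ↔ L.HasWeight ι μ z := by
  simp [weightSpace, HasWeight, Submodule.mem_iInf]

theorem iSupIndep_weightSpace {ι : 𝔥 →ₗ[ℂ] 𝔤} (hι : ∀ h, ι h ∈ L.part 0)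
    (hc : ∀ h h', L.bracket (ι h) (ι h') = 0) : iSupIndep (L.weightSpace ι) := by
  refine iSupIndep.mono (Module.End.independent_iInf_maxGenEigenspace_of_forall_mapsTo
    (fun h => L.bracket (ι h)) fun h k φ => ?_) fun χ => iInf_mono fun h =>
      Module.End.genEigenspace_le_maximal _ _ _
  refine Module.End.mapsTo_genEigenspace_of_comm ?_ _ _
  ext z
  simp [L.bracket_bracket_of_even (hι k), hc]

/-- If weight vectors `t i` span the algebra, a vector of weight `μ` is already in the span of those
`t i` which have weight `μ`. -/
theorem HasWeight.mem_span {ι : 𝔥 →ₗ[ℂ] 𝔤} (hι : ∀ h, ι h ∈ L.part 0)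
    (hc : ∀ h h', L.bracket (ι h) (ι h') = 0) {I : Type*} {t : I → 𝔤} {wt : I → Module.Dual ℂ 𝔥}
    (ht : ∀ i, L.HasWeight ι (wt i) (t i)) (hspan : Submodule.span ℂ (Set.range t) = ⊤)
    {μ : Module.Dual ℂ 𝔥} {z : 𝔤} (hz : L.HasWeight ι μ z) :
    z ∈ Submodule.span ℂ (t '' {i | wt i = μ}) := by
  have hle : Submodule.span ℂ (Set.range t) ≤ Submodule.span ℂ (t '' {i | wt i = μ}) ⊔
      Submodule.span ℂ (t '' {i | wt i ≠ μ}) := by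
    rw [← Submodule.span_union, ← Set.image_union]
    refine Submodule.span_mono ?_
    rintro _ ⟨i, rfl⟩
    exact ⟨i, em _, rfl⟩
  obtain ⟨a, ha, b, hb, rfl⟩ := Submodule.mem_sup.mp (hle (hspan ▸ Submodule.mem_top : z ∈ _))
  have ha' : a ∈ L.weightSpace ι μ := by
    refine Submodule.span_le.mpr ?_ ha
    rintro _ ⟨i, rfl, rfl⟩
    exact mem_weightSpace.mpr (ht i)
  have hb' : b ∈ ⨆ (χ : 𝔥 → ℂ) (_ : χ ≠ μ), L.weightSpace ι χ := by
    refine Submodule.span_le.mpr ?_ hb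
    rintro _ ⟨i, hi, rfl⟩
    exact Submodule.mem_iSup_of_mem _ (Submodule.mem_iSup_of_mem
      (fun h => hi (DFunLike.coe_injective h)) (mem_weightSpace.mpr (ht i)))
  have hb'' : b ∈ L.weightSpace ι μ :=
    ((L.weightSpace ι μ).add_mem_iff_right ha').mp (mem_weightSpace.mpr hz)
  rw [Submodule.disjoint_def.mp (L.iSupIndep_weightSpace hι hc μ) b hb'' hb', add_zero]
  exact ha

end Weights

end LieSuperalgebra

/-! ### The triangular decomposition -/

namespace SuperRootDatum.HalfBakedQuotient

variable {X : Type w} {𝔥 : Type u} [AddCommGroup 𝔥] [Module ℂ 𝔥] {v : SuperRootDatum X 𝔥}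
  (g : HalfBakedQuotient v)

theorem bracket_f_e_mem_range (x y : X) : g.str.bracket (g.f x) (g.e y) ∈ LinearMap.range g.ι := by
  rw [g.str.skew _ _ _ _ (g.f_mem x) (g.e_mem y), g.bracket_e_f]
  refine Submodule.neg_mem _ (Submodule.smul_mem _ _ ?_)
  split_ifs
  · exact ⟨_, rfl⟩
  · exact Submodule.zero_mem _

theorem bracket_e_f_mem_range (x y : X) : g.str.bracket (g.e x) (g.f y) ∈ LinearMap.range g.ι := by
  rw [g.bracket_e_f]
  split_ifs
  · exact ⟨_, rfl⟩
  · exact Submodule.zero_mem _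

theorem bracket_ι_f' (h : 𝔥) (x : X) : g.str.bracket (g.ι h) (g.f x) = (-v.b x) h • g.f x := by
  simp [g.bracket_ι_f]

/-- The triangular decomposition `𝔤 = 𝔫⁺ + 𝔥 + 𝔫⁻` (directness of the sum is not asserted). -/
theorem wordSpan_sup_range_sup_wordSpan :
    g.str.wordSpan g.e ⊔ LinearMap.range g.ι ⊔ g.str.wordSpan g.f = ⊤ := by
  set P := g.str.wordSpan g.e
  set H := LinearMap.range g.ι
  set M := g.str.wordSpan g.f
  have hP : P ≤ P ⊔ H ⊔ M := le_sup_left.trans le_sup_left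
  have hM : M ≤ P ⊔ H ⊔ M := le_sup_right
  have hH : H ≤ P ⊔ H ⊔ M := le_sup_right.trans le_sup_left
  have hPH : P ⊔ H ≤ P ⊔ H ⊔ M := le_sup_left
  have hMH : M ⊔ H ≤ P ⊔ H ⊔ M := sup_le hM hH
  have split : ∀ z ∈ P ⊔ H ⊔ M, ∀ y, (∀ t ∈ P, g.str.bracket y t ∈ P ⊔ H ⊔ M) →
      (∀ h, g.str.bracket y (g.ι h) ∈ P ⊔ H ⊔ M) → (∀ t ∈ M, g.str.bracket y t ∈ P ⊔ H ⊔ M) →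
      g.str.bracket y z ∈ P ⊔ H ⊔ M := by
    intro z hz y h₁ h₂ h₃
    obtain ⟨s, hs, m, hm, rfl⟩ := Submodule.mem_sup.mp hz
    obtain ⟨p, hp, _, ⟨h, rfl⟩, rfl⟩ := Submodule.mem_sup.mp hs
    simp only [map_add]
    exact Submodule.add_mem _ (Submodule.add_mem _ (h₁ p hp) (h₂ h)) (h₃ m hm)
  let G : Set g.carrier := Set.range g.ι ∪ Set.range g.e ∪ Set.range g.f
  have hideal := g.str.bracket_mem_of_generated (G := G) (S := P ⊔ H ⊔ M)
    (by
      rintro _ ((⟨h, rfl⟩ | ⟨x, rfl⟩) | ⟨x, rfl⟩)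
      exacts [⟨_, g.ι_even h⟩, ⟨_, g.e_mem x⟩, ⟨_, g.f_mem x⟩])
    (fun T hT hbr => g.generated T (fun h => hT (Or.inl (Or.inl ⟨h, rfl⟩)))
      (fun x => hT (Or.inl (Or.inr ⟨x, rfl⟩))) (fun x => hT (Or.inr ⟨x, rfl⟩)) hbr)
    (by
      rintro _ ((⟨k, rfl⟩ | ⟨x, rfl⟩) | ⟨x, rfl⟩) z hz
      · refine split z hz _ (fun t ht => hP ?_) (fun h => ?_) (fun t ht => hM ?_)
        · exact g.str.bracket_cartan_mem_wordSpan g.ι_even g.bracket_ι_e k ht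
        · rw [g.bracket_ι_ι]; exact Submodule.zero_mem _
        · exact g.str.bracket_cartan_mem_wordSpan g.ι_even g.bracket_ι_f' k ht
      · refine split z hz _ (fun t ht => hP ?_) (fun h => hP ?_) (fun t ht => hMH ?_)
        · exact g.str.bracket_generator_mem_wordSpan x ht
        · rw [g.str.skew _ _ _ _ (g.e_mem x) (g.ι_even h), g.bracket_ι_e]
          exact Submodule.neg_mem _ (Submodule.smul_mem _ _ (Submodule.smul_mem _ _
            (g.str.word_mem_wordSpan g.e x [])))
        · exact g.str.bracket_opposite_mem g.ι_even g.e_mem g.f_mem g.bracket_ι_f'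
            g.bracket_e_f_mem_range x ht
      · refine split z hz _ (fun t ht => hPH ?_) (fun h => hM ?_) (fun t ht => hM ?_)
        · exact g.str.bracket_opposite_mem g.ι_even g.f_mem g.e_mem g.bracket_ι_e
            g.bracket_f_e_mem_range x ht
        · rw [g.str.skew _ _ _ _ (g.f_mem x) (g.ι_even h), g.bracket_ι_f]
          exact Submodule.neg_mem _ (Submodule.smul_mem _ _ (Submodule.neg_mem _
            (Submodule.smul_mem _ _ (g.str.word_mem_wordSpan g.f x []))))
        · exact g.str.bracket_generator_mem_wordSpan x ht)
  exact g.generated _ (fun h => hH ⟨h, rfl⟩) (fun x => hP (g.str.word_mem_wordSpan g.e x []))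
    (fun x => hM (g.str.word_mem_wordSpan g.f x [])) fun y _ z hz => hideal y hz

/-- The spanning family of weight vectors given by the triangular decomposition. -/
def triangularFamily : (X × List X) ⊕ 𝔥 ⊕ (X × List X) → g.carrier
  | .inl q => g.str.word g.e q.1 q.2
  | .inr (.inl h) => g.ι h
  | .inr (.inr q) => g.str.word g.f q.1 q.2

/-- The weights of the members of `triangularFamily`. -/
def triangularWeight (v : SuperRootDatum X 𝔥) :
    (X × List X) ⊕ 𝔥 ⊕ (X × List X) → Module.Dual ℂ 𝔥
  | .inl q => v.b q.1 + (q.2.map v.b).sum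
  | .inr (.inl _) => 0
  | .inr (.inr q) => -(v.b q.1 + (q.2.map v.b).sum)

theorem hasWeight_triangularFamily (i) :
    g.str.HasWeight g.ι (triangularWeight v i) (g.triangularFamily i) := by
  intro k
  rcases i with q | h | q
  · exact g.str.bracket_word g.ι_even g.bracket_ι_e k q.1 q.2
  · simpa [triangularFamily, triangularWeight] using g.bracket_ι_ι k h
  · have : ∀ l : List X, (l.map fun x => -v.b x).sum = -(l.map v.b).sum := by
      intro l
      induction l with
      | nil => simp
      | cons y l ih => simp only [List.map_cons, List.sum_cons, ih, neg_add]
    simp only [triangularFamily, triangularWeight, neg_add, ← this]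
    exact g.str.bracket_word g.ι_even g.bracket_ι_f' k q.1 q.2

theorem span_triangularFamily : Submodule.span ℂ (Set.range g.triangularFamily) = ⊤ := by
  rw [eq_top_iff, ← g.wordSpan_sup_range_sup_wordSpan]
  refine sup_le (sup_le (Submodule.span_le.mpr ?_) ?_) (Submodule.span_le.mpr ?_)
  · rintro _ ⟨q, rfl⟩
    exact Submodule.subset_span ⟨.inl q, rfl⟩
  · rintro _ ⟨h, rfl⟩
    exact Submodule.subset_span ⟨.inr (.inl h), rfl⟩
  · rintro _ ⟨q, rfl⟩
    exact Submodule.subset_span ⟨.inr (.inr q), rfl⟩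

theorem mem_span_of_hasWeight {μ : Module.Dual ℂ 𝔥} {z : g.carrier}
    (hz : g.str.HasWeight g.ι μ z) :
    z ∈ Submodule.span ℂ (g.triangularFamily '' {i | triangularWeight v i = μ}) :=
  hz.mem_span g.str g.ι_even g.bracket_ι_ι g.hasWeight_triangularFamily g.span_triangularFamily

end SuperRootDatum.HalfBakedQuotient

/-! ### Coefficients and heights in `Q⁺` -/

namespace SuperRootDatum

variable {X : Type w} {𝔥 : Type u} [AddCommGroup 𝔥] [Module ℂ 𝔥] (v : SuperRootDatum X 𝔥)

theorem b_mem_positiveCone (x : X) : v.b x ∈ v.positiveCone :=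
  AddSubmonoid.subset_closure ⟨x, rfl⟩

theorem list_sum_mem_positiveCone (l : List X) : (l.map v.b).sum ∈ v.positiveCone :=
  AddSubmonoid.list_sum_mem _ fun y hy => by
    obtain ⟨x, -, rfl⟩ := List.mem_map.mp hy
    exact v.b_mem_positiveCone x

/-- All weights of a quotient of the half-baked superalgebra lie in `Q⁺ ∪ -Q⁺`. -/
theorem HalfBakedQuotient.mem_positiveCone_or_neg_mem (g : HalfBakedQuotient v)
    {μ : Module.Dual ℂ 𝔥} {z : g.carrier} (hz : g.str.HasWeight g.ι μ z) (h0 : z ≠ 0) :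
    μ ∈ v.positiveCone ∨ -μ ∈ v.positiveCone := by
  by_contra hcon
  have h := g.mem_span_of_hasWeight hz
  have : {i | triangularWeight v i = μ} = ∅ := by
    rw [Set.eq_empty_iff_forall_notMem]
    rintro i rfl
    refine hcon ?_
    rcases i with q | k | q
    · exact Or.inl (add_mem (v.b_mem_positiveCone _) (v.list_sum_mem_positiveCone _))
    · exact Or.inl (zero_mem _)
    · refine Or.inr ?_
      simp only [triangularWeight, neg_neg]
      exact add_mem (v.b_mem_positiveCone _) (v.list_sum_mem_positiveCone _)
  rw [this, Set.image_empty, Submodule.span_empty] at h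
  exact h0 ((Submodule.mem_bot ℂ).mp h)

/-- A linear form on the dual of the Cartan space, giving the coefficient of `b x` in linear
combinations of simple roots. -/
noncomputable def coord (x : X) : Module.Dual ℂ 𝔥 →ₗ[ℂ] ℂ :=
  Finsupp.lapply x ∘ₗ (Finsupp.linearCombination ℂ v.b).leftInverse

/-- A linear form on the dual of the Cartan space, giving the sum of the coefficients in linear
combinations of simple roots. -/
noncomputable def height : Module.Dual ℂ 𝔥 →ₗ[ℂ] ℂ :=
  Finsupp.linearCombination ℂ (fun _ : X => (1 : ℂ)) ∘ₗ
    (Finsupp.linearCombination ℂ v.b).leftInverse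

theorem leftInverse_b (y : X) :
    (Finsupp.linearCombination ℂ v.b).leftInverse (v.b y) = Finsupp.single y 1 := by
  have h := LinearMap.leftInverse_apply_of_inj
    (LinearMap.ker_eq_bot.mpr v.linearIndependent_b) (Finsupp.single y (1 : ℂ))
  rwa [Finsupp.linearCombination_single, one_smul] at h

theorem coord_b_self (x : X) : v.coord x (v.b x) = 1 := by
  simp [coord, leftInverse_b]

theorem coord_b_of_ne {x y : X} (h : y ≠ x) : v.coord x (v.b y) = 0 := by
  simp [coord, leftInverse_b, h]

theorem height_b (x : X) : v.height (v.b x) = 1 := by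
  simp [height, leftInverse_b]

theorem exists_coord_eq_natCast {μ : Module.Dual ℂ 𝔥} (h : μ ∈ v.positiveCone) (x : X) :
    ∃ n : ℕ, v.coord x μ = n := by
  induction h using AddSubmonoid.closure_induction with
  | mem μ h =>
    obtain ⟨y, rfl⟩ := h
    by_cases hy : y = x
    · exact ⟨1, by simp [hy, coord_b_self]⟩
    · exact ⟨0, by simp [v.coord_b_of_ne hy]⟩
  | zero => exact ⟨0, by simp⟩
  | add μ ν _ _ h₁ h₂ =>
    obtain ⟨m, hm⟩ := h₁
    obtain ⟨n, hn⟩ := h₂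
    exact ⟨m + n, by simp [hm, hn]⟩

theorem eq_zero_or_height_eq {μ : Module.Dual ℂ 𝔥} (h : μ ∈ v.positiveCone) :
    μ = 0 ∨ ∃ n : ℕ, v.height μ = n + 1 := by
  induction h using AddSubmonoid.closure_induction with
  | mem μ h => obtain ⟨y, rfl⟩ := h; exact Or.inr ⟨0, by simp [height_b]⟩
  | zero => exact Or.inl rfl
  | add μ ν _ _ h₁ h₂ =>
    rcases h₁ with rfl | ⟨m, hm⟩
    · simpa using h₂
    rcases h₂ with rfl | ⟨n, hn⟩
    · exact Or.inr ⟨m, by simp [hm]⟩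
    · exact Or.inr ⟨m + n + 1, by simp only [map_add, hm, hn]; push_cast; ring⟩

theorem eq_zero_of_neg_mem {μ : Module.Dual ℂ 𝔥} (h : μ ∈ v.positiveCone)
    (h' : -μ ∈ v.positiveCone) : μ = 0 := by
  rcases v.eq_zero_or_height_eq h with h0 | ⟨m, hm⟩
  · exact h0
  rcases v.eq_zero_or_height_eq h' with h0 | ⟨n, hn⟩
  · exact neg_eq_zero.mp h0
  · rw [map_neg, hm] at hn
    have : ((m + n + 2 : ℕ) : ℂ) = 0 := by push_cast; linear_combination -hn
    exact absurd (Nat.cast_eq_zero.mp this) (by omega)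

/-- An element of `Q⁺` all of whose coefficients away from `x` vanish is a multiple of `b x`. -/
theorem exists_eq_nsmul {μ : Module.Dual ℂ 𝔥} (h : μ ∈ v.positiveCone) {x : X}
    (h0 : ∀ y, y ≠ x → v.coord y μ = 0) : ∃ n : ℕ, μ = n • v.b x := by
  induction h using AddSubmonoid.closure_induction with
  | mem μ h =>
    obtain ⟨y, rfl⟩ := h
    by_cases hy : y = x
    · exact ⟨1, by simp [hy]⟩
    · simpa [coord_b_self] using h0 y hy
  | zero => exact ⟨0, by simp⟩
  | add μ ν hμ hν h₁ h₂ =>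
    have key : ∀ y, y ≠ x → v.coord y μ = 0 ∧ v.coord y ν = 0 := by
      intro y hy
      obtain ⟨m, hm⟩ := v.exists_coord_eq_natCast hμ y
      obtain ⟨n, hn⟩ := v.exists_coord_eq_natCast hν y
      have := h0 y hy
      rw [map_add, hm, hn] at this
      rw [hm, hn]
      norm_cast at this ⊢
      omega
    obtain ⟨m, hm⟩ := h₁ fun y hy => (key y hy).1
    obtain ⟨n, hn⟩ := h₂ fun y hy => (key y hy).2
    exact ⟨m + n, by rw [add_smul, ← hm, ← hn]⟩

theorem b_ne_zero (x : X) : v.b x ≠ 0 := v.linearIndependent_b.ne_zero x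

theorem eq_nil_of_sum_eq {x y : X} {l : List X} (h : v.b y + (l.map v.b).sum = v.b x) :
    l = [] ∧ y = x := by
  have hl : l = [] := by
    cases l with
    | nil => rfl
    | cons t l =>
      exfalso
      have hmem : (l.map v.b).sum ∈ v.positiveCone := v.list_sum_mem_positiveCone l
      have hh := congrArg v.height h
      simp only [List.map_cons, List.sum_cons, map_add, height_b] at hh
      rcases v.eq_zero_or_height_eq hmem with h0 | ⟨n, hn⟩
      · rw [h0, map_zero] at hh
        norm_num at hh
      · rw [hn] at hh
        have : ((n + 2 : ℕ) : ℂ) = 0 := by push_cast; linear_combination hh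
        exact absurd (Nat.cast_eq_zero.mp this) (by omega)
  subst hl
  exact ⟨rfl, v.linearIndependent_b.injective (by simpa using h)⟩

theorem b_add_list_sum_ne_zero (y : X) (l : List X) : v.b y + (l.map v.b).sum ≠ 0 := by
  intro h
  refine v.b_ne_zero y (v.eq_zero_of_neg_mem (v.b_mem_positiveCone y) ?_)
  rw [neg_eq_of_add_eq_zero_right h]
  exact v.list_sum_mem_positiveCone l

theorem b_add_list_sum_ne_neg_b (x y : X) (l : List X) : v.b y + (l.map v.b).sum ≠ -v.b x := by
  intro h
  refine v.b_add_list_sum_ne_zero y (x :: l) ?_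
  rw [List.map_cons, List.sum_cons, add_left_comm, h, add_neg_cancel]

/-- The weight space of a simple root `b x` is spanned by `e x`. -/
theorem HalfBakedQuotient.exists_eq_smul_e (g : HalfBakedQuotient v) {x : X} {z : g.carrier}
    (hz : g.str.HasWeight g.ι (v.b x) z) : ∃ c : ℂ, z = c • g.e x := by
  have h := g.mem_span_of_hasWeight hz
  have hsub : g.triangularFamily '' {i | triangularWeight v i = v.b x} ⊆ {g.e x} := by
    rintro _ ⟨q | k | q, hi, rfl⟩
    · obtain ⟨y, l⟩ := q
      obtain ⟨rfl, rfl⟩ := v.eq_nil_of_sum_eq hi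
      rfl
    · exact absurd hi.symm (v.b_ne_zero x)
    · exact absurd (neg_eq_iff_eq_neg.mp hi) (v.b_add_list_sum_ne_neg_b x q.1 q.2)
  obtain ⟨c, hc⟩ := Submodule.mem_span_singleton.mp (Submodule.span_mono hsub h)
  exact ⟨c, hc.symm⟩

/-- The weight space of `-b x` is spanned by `f x`. -/
theorem HalfBakedQuotient.exists_eq_smul_f (g : HalfBakedQuotient v) {x : X} {z : g.carrier}
    (hz : g.str.HasWeight g.ι (-v.b x) z) : ∃ c : ℂ, z = c • g.f x := by
  have h := g.mem_span_of_hasWeight hz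
  have hsub : g.triangularFamily '' {i | triangularWeight v i = -v.b x} ⊆ {g.f x} := by
    rintro _ ⟨q | k | q, hi, rfl⟩
    · exact absurd hi (v.b_add_list_sum_ne_neg_b x q.1 q.2)
    · exact absurd (neg_eq_zero.mp hi.symm) (v.b_ne_zero x)
    · obtain ⟨y, l⟩ := q
      obtain ⟨rfl, rfl⟩ := v.eq_nil_of_sum_eq (neg_injective hi)
      rfl
  obtain ⟨c, hc⟩ := Submodule.mem_span_singleton.mp (Submodule.span_mono hsub h)
  exact ⟨c, hc.symm⟩

end SuperRootDatum

/-! ### Transfer along the isomorphisms of a root algebra -/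

namespace SuperRootDatum

variable {X : Type w} {𝔥 : Type u} [AddCommGroup 𝔥] [Module ℂ 𝔥]

theorem arrow_of_mem_skeleton {v u : SuperRootDatum X 𝔥} (hu : u ∈ v.skeleton) :
    Arrow v u (LinearEquiv.refl ℂ 𝔥) := by
  induction hu with
  | refl => exact Arrow.id v
  | tail _ h ih =>
    obtain ⟨x, hx⟩ := h
    exact ih.comp (Arrow.reflexion _ _ x hx)

/-- The isomorphism is the composite of those attached to the two arrows out of `v`; it is the
identity on the common Cartan space. -/
theorem Admissible.exists_equiv {v u u' : SuperRootDatum X 𝔥} (hv : v.Admissible)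
    (hu : u ∈ v.skeleton) (hu' : u' ∈ v.skeleton) :
    ∃ (g : HalfBakedQuotient u) (g' : HalfBakedQuotient u') (ψ : g.carrier ≃ₗ[ℂ] g'.carrier),
      (∀ y z, ψ (g.str.bracket y z) = g'.str.bracket (ψ y) (ψ z)) ∧ ∀ h, ψ (g.ι h) = g'.ι h := by
  obtain ⟨R⟩ := hv
  have h₀ : ∃ θ, Arrow v v θ := ⟨_, Arrow.id v⟩
  have h₁ := arrow_of_mem_skeleton hu
  have h₂ := arrow_of_mem_skeleton hu'
  obtain ⟨φ, -, hφ, hφι⟩ := R.extends_arrow v u h₀ ⟨_, h₁⟩ _ h₁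
  obtain ⟨φ', -, hφ', hφι'⟩ := R.extends_arrow v u' h₀ ⟨_, h₂⟩ _ h₂
  refine ⟨_, _, φ.symm.trans φ', fun y z => ?_, fun h => ?_⟩
  · obtain ⟨y, rfl⟩ := φ.surjective y
    obtain ⟨z, rfl⟩ := φ.surjective z
    simp [← hφ, hφ']
  · have : (R.alg u ⟨_, h₁⟩).ι h = φ ((R.alg v h₀).ι h) := (hφι h).symm
    rw [this]
    simpa using hφι' h

theorem HalfBakedQuotient.e_ne_zero {v : SuperRootDatum X 𝔥} (g : HalfBakedQuotient v) (x : X) :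
    g.e x ≠ 0 := by
  intro h
  have := g.bracket_e_f x x
  rw [h, if_pos rfl, map_zero, LinearMap.zero_apply, eq_comm,
    map_eq_zero_iff _ g.ι_injective] at this
  exact v.linearIndependent_a.ne_zero x this

/-- A simple root at one vertex of the skeleton is positive or negative at every other one: it is a
weight of the common root algebra. -/
theorem Admissible.b_mem_or_neg_mem {v u u' : SuperRootDatum X 𝔥} (hv : v.Admissible)
    (hu : u ∈ v.skeleton) (hu' : u' ∈ v.skeleton) (x : X) :
    u.b x ∈ u'.positiveCone ∨ -u.b x ∈ u'.positiveCone := by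
  obtain ⟨g, g', ψ, hψ, hι⟩ := hv.exists_equiv hu hu'
  refine HalfBakedQuotient.mem_positiveCone_or_neg_mem u' g' (z := ψ (g.e x)) (fun h => ?_)
    ((map_ne_zero_iff ψ ψ.injective).mpr (g.e_ne_zero x))
  rw [← hι, ← hψ, g.bracket_ι_e, map_smul]

/-- In an admissible component a simple root determines its coroot line: the root spaces of a
simple root and of its negative are one-dimensional, and the coroot spans their bracket. -/
theorem Admissible.exists_a_eq_smul {v u u' : SuperRootDatum X 𝔥} (hv : v.Admissible)
    (hu : u ∈ v.skeleton) (hu' : u' ∈ v.skeleton) {x y : X}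
    (h : u.b x = u'.b y ∨ u.b x = -u'.b y) : ∃ c : ℂ, c ≠ 0 ∧ u.a x = c • u'.a y := by
  obtain ⟨g, g', ψ, hψ, hι⟩ := hv.exists_equiv hu hu'
  have hwe : g'.str.HasWeight g'.ι (u.b x) (ψ (g.e x)) := fun k => by
    rw [← hι, ← hψ, g.bracket_ι_e, map_smul]
  have hwf : g'.str.HasWeight g'.ι (-u.b x) (ψ (g.f x)) := fun k => by
    rw [← hι, ← hψ, g.bracket_ι_f', map_smul]
  have hbr : g'.ι (u.a x) = g'.str.bracket (ψ (g.e x)) (ψ (g.f x)) := by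
    rw [← hψ, g.bracket_e_f, if_pos rfl, hι]
  suffices ∃ c : ℂ, u.a x = c • u'.a y by
    obtain ⟨c, hc⟩ := this
    refine ⟨c, ?_, hc⟩
    rintro rfl
    exact u.linearIndependent_a.ne_zero x (by simpa using hc)
  rcases h with h | h
  · rw [h] at hwe hwf
    obtain ⟨c, hc⟩ := g'.exists_eq_smul_e u' hwe
    obtain ⟨d, hd⟩ := g'.exists_eq_smul_f u' hwf
    refine ⟨d * c, g'.ι_injective ?_⟩
    rw [hbr, hc, hd]
    simp [g'.bracket_e_f, mul_smul]
  · rw [h] at hwe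
    rw [h, neg_neg] at hwf
    obtain ⟨c, hc⟩ := g'.exists_eq_smul_f u' hwe
    obtain ⟨d, hd⟩ := g'.exists_eq_smul_e u' hwf
    refine ⟨d * (c * -(-1 : ℂ) ^ (u'.p y * u'.p y).val), g'.ι_injective ?_⟩
    rw [hbr, hc, hd]
    simp [g'.str.skew _ _ _ _ (g'.f_mem y) (g'.e_mem y), g'.bracket_e_f, mul_smul]

/-! ### Isotropic reflexions are involutive -/

theorem reflectable_isotropicReflexion {u : SuperRootDatum X 𝔥} {x : X} (h : u.Reflectable x)
    (h0 : u.cartan x x = 0) :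
    (u.isotropicReflexion x).Reflectable x ∧ (u.isotropicReflexion x).cartan x x = 0 := by
  have hc : (u.isotropicReflexion x).cartan x x = 0 := by
    have : u.b x (u.a x) = 0 := h0
    simp [cartan, isotropicReflexion, this]
  have hp : u.p x = 1 := by
    rcases h with h | h | h
    exacts [h.2, absurd h0 h.1, absurd h0 h.1]
  exact ⟨Or.inl ⟨hc, by simp [isotropicReflexion, hp]⟩, hc⟩

open Classical in
theorem isotropicReflexion_a (u : SuperRootDatum X 𝔥) (x y : X) :
    (u.isotropicReflexion x).a y = if y = x then -u.a x else if u.cartan x y = 0 then u.a y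
      else u.a y + (u.cartan y x / u.cartan x y) • u.a x := rfl

open Classical in
theorem isotropicReflexion_b (u : SuperRootDatum X 𝔥) (x y : X) :
    (u.isotropicReflexion x).b y = if y = x then -u.b x else if u.cartan x y = 0 then u.b y
      else u.b y + u.b x := rfl

open Classical in
theorem isotropicReflexion_p (u : SuperRootDatum X 𝔥) (x y : X) :
    (u.isotropicReflexion x).p y = if y = x then u.p x else if u.cartan x y = 0 then u.p y
      else u.p y + 1 := rfl

theorem isotropicReflexion_isotropicReflexion {u : SuperRootDatum X 𝔥} {x : X}
    (h0 : u.cartan x x = 0) : (u.isotropicReflexion x).isotropicReflexion x = u := by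
  have h0' : u.b x (u.a x) = 0 := h0
  have hxy : ∀ y, y ≠ x → (u.isotropicReflexion x).cartan x y = -u.cartan x y := by
    intro y hy
    simp only [cartan, isotropicReflexion_a, isotropicReflexion_b, if_neg hy, if_pos]
    by_cases h : u.b y (u.a x) = 0 <;> simp [h, h0']
  have hyx : ∀ y, y ≠ x → (u.isotropicReflexion x).cartan y x = -u.cartan y x := by
    intro y hy
    simp only [cartan, isotropicReflexion_a, isotropicReflexion_b, if_neg hy, if_pos]
    by_cases h : u.b y (u.a x) = 0 <;> simp [h, h0']
  ext1
  · funext y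
    by_cases hy : y = x
    · subst hy; simp [isotropicReflexion_a]
    · rw [isotropicReflexion_a _ _ y, if_neg hy, hxy y hy, hyx y hy]
      by_cases h : u.cartan x y = 0 <;> simp [isotropicReflexion_a, hy, h]
  · funext y
    by_cases hy : y = x
    · subst hy; simp [isotropicReflexion_b]
    · rw [isotropicReflexion_b _ _ y, if_neg hy, hxy y hy]
      by_cases h : u.cartan x y = 0 <;> simp [isotropicReflexion_b, hy, h]
  · funext y
    by_cases hy : y = x
    · subst hy; simp [isotropicReflexion_p]
    · rw [isotropicReflexion_p _ _ y, if_neg hy, hxy y hy]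
      by_cases h : u.cartan x y = 0
      · simp [isotropicReflexion_p, hy, h]
      · simp [isotropicReflexion_p, hy, h, add_assoc, CharTwo.add_self_eq_zero]

theorem IsIsotropicReflexion.symm {u u' : SuperRootDatum X 𝔥} {x : X}
    (h : u.IsIsotropicReflexion x u') : u'.IsIsotropicReflexion x u := by
  obtain ⟨h₁, h₂, rfl⟩ := h
  obtain ⟨h₃, h₄⟩ := reflectable_isotropicReflexion h₁ h₂
  exact ⟨h₃, h₄, (isotropicReflexion_isotropicReflexion h₂).symm⟩

theorem mem_spine_symm {u u' : SuperRootDatum X 𝔥} (h : u' ∈ u.spine) : u ∈ u'.spine := by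
  induction h with
  | refl => exact .refl
  | tail _ h ih =>
    obtain ⟨x, hx⟩ := h
    exact .head ⟨x, hx.symm⟩ ih

theorem mem_skeleton_of_mem_spine {v u u' : SuperRootDatum X 𝔥} (hu : u ∈ v.skeleton)
    (h : u' ∈ u.spine) : u' ∈ v.skeleton := by
  induction h with
  | refl => exact hu
  | tail _ h ih =>
    obtain ⟨x, hx⟩ := h
    exact .tail ih ⟨x, Or.inl hx⟩

/-! ### The reflection of an anisotropic simple root -/

/-- The reflection `h ↦ h - 2 ⟨h, b x⟩ / a_{xx} • a x` of the Cartan space. -/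
noncomputable def rootReflection (u : SuperRootDatum X 𝔥) (x : X) (hx : u.cartan x x ≠ 0) :
    𝔥 ≃ₗ[ℂ] 𝔥 :=
  Module.reflection (x := u.a x) (f := (2 / u.cartan x x) • u.b x)
    (by simpa [cartan] using div_mul_cancel₀ 2 hx)

theorem rootReflection_apply (u : SuperRootDatum X 𝔥) (x : X) (hx : u.cartan x x ≠ 0) (h : 𝔥) :
    u.rootReflection x hx h = h - (2 / u.cartan x x * u.b x h) • u.a x := by
  simp [rootReflection, Module.reflection_apply]

@[simp]
theorem rootReflection_symm (u : SuperRootDatum X 𝔥) (x : X) (hx : u.cartan x x ≠ 0) :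
    (u.rootReflection x hx).symm = u.rootReflection x hx := rfl

theorem transport_rootReflection_b (u : SuperRootDatum X 𝔥) (x : X) (hx : u.cartan x x ≠ 0)
    (w : SuperRootDatum X 𝔥) (y : X) :
    (w.transport (u.rootReflection x hx)).b y =
      w.b y - (2 / u.cartan x x * w.b y (u.a x)) • u.b x := by
  ext h
  simp only [transport, rootReflection_symm, LinearEquiv.dualMap_apply, rootReflection_apply,
    map_sub, map_smul, smul_eq_mul, LinearMap.sub_apply, LinearMap.smul_apply]
  ring

/-- An anisotropic reflexion is the transport of structure along the reflection in its simple
root. -/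
theorem anisotropicReflexion_eq_transport (u : SuperRootDatum X 𝔥) (x : X)
    (hx : u.cartan x x ≠ 0) :
    u.anisotropicReflexion x hx = u.transport (u.rootReflection x hx) := by
  ext1
  · funext y
    change _ = u.rootReflection x hx (u.a y)
    rw [rootReflection_apply]
    simp only [anisotropicReflexion, cartan]
    congr 2
    ring
  · funext y
    rw [transport_rootReflection_b]
    simp only [anisotropicReflexion, cartan]
    congr 2
    ring
  · rfl

theorem transport_rootReflection_transport (u : SuperRootDatum X 𝔥) (x : X)
    (hx : u.cartan x x ≠ 0) (w : SuperRootDatum X 𝔥) :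
    (w.transport (u.rootReflection x hx)).transport (u.rootReflection x hx) = w := by
  have hinv : ∀ h, u.rootReflection x hx (u.rootReflection x hx h) = h :=
    fun h => Module.involutive_reflection _ h
  ext1
  · funext y; exact hinv _
  · funext y
    ext h
    exact congrArg _ (hinv h)
  · rfl

theorem cartan_transport (w : SuperRootDatum X 𝔥) (θ : 𝔥 ≃ₗ[ℂ] 𝔥) (x y : X) :
    (w.transport θ).cartan x y = w.cartan x y := by
  simp [cartan, transport]

theorem reflectable_transport_iff {w : SuperRootDatum X 𝔥} {θ : 𝔥 ≃ₗ[ℂ] 𝔥} {x : X} :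
    (w.transport θ).Reflectable x ↔ w.Reflectable x := by
  simp only [Reflectable, cartan_transport]
  rfl

/-- Isotropic reflexions commute with transport of structure. -/
theorem IsIsotropicReflexion.transport {w w' : SuperRootDatum X 𝔥} {x : X}
    (h : w.IsIsotropicReflexion x w') (θ : 𝔥 ≃ₗ[ℂ] 𝔥) :
    (w.transport θ).IsIsotropicReflexion x (w'.transport θ) := by
  obtain ⟨h₁, h₂, rfl⟩ := h
  refine ⟨reflectable_transport_iff.mpr h₁, by rwa [cartan_transport], ?_⟩
  ext1
  · funext y
    simp only [isotropicReflexion, cartan_transport]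
    simp only [SuperRootDatum.transport]
    split_ifs <;> simp
  · funext y
    simp only [isotropicReflexion, cartan_transport]
    simp only [SuperRootDatum.transport]
    split_ifs <;> simp
  · funext y
    simp only [isotropicReflexion, cartan_transport]
    simp only [SuperRootDatum.transport]

/-- Anisotropic reflexions commute with transport of structure. -/
theorem IsAnisotropicReflexion.transport {w w' : SuperRootDatum X 𝔥} {x : X}
    (h : w.IsAnisotropicReflexion x w') (θ : 𝔥 ≃ₗ[ℂ] 𝔥) :
    (w.transport θ).IsAnisotropicReflexion x (w'.transport θ) := by
  obtain ⟨h₁, h₂, rfl⟩ := h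
  refine ⟨reflectable_transport_iff.mpr h₁, by rwa [cartan_transport], ?_⟩
  ext1
  · funext y
    simp only [anisotropicReflexion, cartan_transport]
    simp [SuperRootDatum.transport]
  · funext y
    simp only [anisotropicReflexion, cartan_transport]
    simp only [SuperRootDatum.transport, map_sub, map_smul]
  · rfl

theorem transport_mem_spine {w w' : SuperRootDatum X 𝔥} (h : w' ∈ w.spine) (θ : 𝔥 ≃ₗ[ℂ] 𝔥) :
    w'.transport θ ∈ (w.transport θ).spine := by
  induction h with
  | refl => exact .refl
  | tail _ h ih =>
    obtain ⟨x, hx⟩ := h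
    exact .tail ih ⟨x, hx.transport θ⟩

/-! ### The effect of a reflexion on `Q⁺` -/

/-- The effect of any reflexion on simple roots: `b x` changes sign, and multiples of `b x` are
added to the others. -/
theorem IsReflexion.b_eq {u u' : SuperRootDatum X 𝔥} {x : X} (h : u.IsReflexion x u') :
    u'.b x = -u.b x ∧ ∀ y, y ≠ x → ∃ c : ℂ, u'.b y = u.b y + c • u.b x := by
  rcases h with ⟨-, -, rfl⟩ | ⟨-, hx, rfl⟩
  · refine ⟨by simp [isotropicReflexion], fun y hy => ?_⟩
    simp only [isotropicReflexion, if_neg hy]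
    split_ifs
    exacts [⟨0, by simp⟩, ⟨1, by simp⟩]
  · refine ⟨?_, fun y _ => ⟨-(2 * u.cartan x y / u.cartan x x), ?_⟩⟩
    · simp only [anisotropicReflexion, mul_div_assoc, div_self hx]
      module
    · simp only [anisotropicReflexion]
      module

/-- Only multiples of `b x` can be positive before and negative after the reflexion `r_x`. -/
theorem IsReflexion.exists_eq_nsmul {u u' : SuperRootDatum X 𝔥} {x : X} (h : u.IsReflexion x u')
    {μ : Module.Dual ℂ 𝔥} (h₁ : μ ∈ u.positiveCone) (h₂ : -μ ∈ u'.positiveCone) :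
    ∃ n : ℕ, μ = n • u.b x := by
  obtain ⟨hx, hb⟩ := h.b_eq
  refine u.exists_eq_nsmul h₁ fun y hy => ?_
  have hcoord : ∀ ν ∈ u'.positiveCone, u.coord y ν = u'.coord y ν := by
    intro ν hν
    induction hν using AddSubmonoid.closure_induction with
    | mem ν h =>
      obtain ⟨z, rfl⟩ := h
      by_cases hz : z = x
      · subst hz
        rw [u'.coord_b_of_ne hy.symm, hx, map_neg, u.coord_b_of_ne hy.symm, neg_zero]
      · obtain ⟨c, hc⟩ := hb z hz
        have : u.coord y (u'.b z) = u.coord y (u.b z) := by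
          rw [hc, map_add, map_smul, u.coord_b_of_ne hy.symm, smul_zero, add_zero]
        rw [this]
        by_cases hzy : z = y
        · subst hzy; rw [coord_b_self, coord_b_self]
        · rw [u.coord_b_of_ne hzy, u'.coord_b_of_ne hzy]
    | zero => simp
    | add a b _ _ ha hb => simp [ha, hb]
  obtain ⟨m, hm⟩ := u.exists_coord_eq_natCast h₁ y
  obtain ⟨n, hn⟩ := u'.exists_coord_eq_natCast h₂ y
  rw [← hcoord _ h₂, map_neg, hm] at hn
  have : ((m + n : ℕ) : ℂ) = 0 := by push_cast; linear_combination -hn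
  have := Nat.cast_eq_zero.mp this
  rw [hm, show m = 0 by omega, Nat.cast_zero]

end SuperRootDatum

/-! ### Signs of real roots -/

namespace SuperRootDatum

variable {X : Type w} {𝔥 : Type u} [AddCommGroup 𝔥] [Module ℂ 𝔥]

/-- Simple roots at vertices of the skeleton are primitive: none is a proper multiple of another,
since each is an integral combination of the simple roots at any other vertex. -/
theorem Admissible.eq_one_of_nsmul_b {v u₀ u : SuperRootDatum X 𝔥} (hv : v.Admissible)
    (hu₀ : u₀ ∈ v.skeleton) (hu : u ∈ v.skeleton) {x₀ x : X} {n : ℕ}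
    (h : n • u.b x = u₀.b x₀ ∨ n • u.b x = -u₀.b x₀) : n = 1 := by
  have hm : ∃ m : ℤ, u₀.coord x₀ (u.b x) = m := by
    rcases hv.b_mem_or_neg_mem hu hu₀ x with h | h
    · obtain ⟨m, hm⟩ := u₀.exists_coord_eq_natCast h x₀
      exact ⟨m, by simpa using hm⟩
    · obtain ⟨m, hm⟩ := u₀.exists_coord_eq_natCast h x₀
      refine ⟨-m, ?_⟩
      rw [map_neg] at hm
      push_cast
      linear_combination -hm
  obtain ⟨m, hm⟩ := hm
  have hunit : IsUnit (n : ℤ) := by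
    rcases h with h | h
    · have := congrArg (u₀.coord x₀) h
      rw [map_nsmul, hm, coord_b_self, nsmul_eq_mul] at this
      exact IsUnit.of_mul_eq_one m (by exact_mod_cast this)
    · have := congrArg (u₀.coord x₀) h
      rw [map_nsmul, hm, map_neg, coord_b_self, nsmul_eq_mul] at this
      refine IsUnit.of_mul_eq_one (-m) ?_
      rw [mul_neg, neg_eq_iff_eq_neg]
      exact_mod_cast this
  simpa [Int.ofNat_isUnit] using hunit

/-- If a real root (up to sign) is positive before and negative after the reflexion `r_x`, it is
`b x` itself. -/
theorem Admissible.eq_b_of_mem_of_neg_mem {v u₀ u u' : SuperRootDatum X 𝔥} (hv : v.Admissible)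
    (hu₀ : u₀ ∈ v.skeleton) (hu : u ∈ v.skeleton) {x₀ x : X} (hr : u.IsReflexion x u')
    {μ : Module.Dual ℂ 𝔥} (hμ : μ = u₀.b x₀ ∨ μ = -u₀.b x₀) (h₁ : μ ∈ u.positiveCone)
    (h₂ : -μ ∈ u'.positiveCone) : μ = u.b x := by
  obtain ⟨n, rfl⟩ := hr.exists_eq_nsmul h₁ h₂
  rw [hv.eq_one_of_nsmul_b hu₀ hu hμ, one_smul]

/-- Isotropic reflexions do not change the sign of anisotropic real roots: the only roots whose sign
changes are `± b x`, and `a x` is orthogonal to `b x`. -/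
theorem Admissible.mem_of_isIsotropicReflexion {v u₀ u u' : SuperRootDatum X 𝔥}
    (hv : v.Admissible) (hu₀ : u₀ ∈ v.skeleton) (hu : u ∈ v.skeleton) {x₀ x : X}
    (hx₀ : u₀.cartan x₀ x₀ ≠ 0) (hr : u.IsIsotropicReflexion x u')
    (h : u₀.b x₀ ∈ u.positiveCone) : u₀.b x₀ ∈ u'.positiveCone := by
  have hu' : u' ∈ v.skeleton := hu.tail ⟨x, Or.inl hr⟩
  refine (hv.b_mem_or_neg_mem hu₀ hu' x₀).resolve_right fun hneg => hx₀ ?_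
  have heq := hv.eq_b_of_mem_of_neg_mem hu₀ hu (Or.inl hr) (Or.inl rfl) h hneg
  obtain ⟨c, -, hc⟩ := hv.exists_a_eq_smul hu₀ hu (Or.inl heq)
  have h0 : u.b x (u.a x) = 0 := hr.2.1
  rw [cartan, hc, heq, map_smul, h0, smul_zero]

theorem Admissible.mem_of_mem_spine {v u₀ u u' : SuperRootDatum X 𝔥}
    (hv : v.Admissible) (hu₀ : u₀ ∈ v.skeleton) (hu : u ∈ v.skeleton) {x₀ : X}
    (hx₀ : u₀.cartan x₀ x₀ ≠ 0) (hs : u' ∈ u.spine)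
    (h : u₀.b x₀ ∈ u.positiveCone) : u₀.b x₀ ∈ u'.positiveCone := by
  induction hs with
  | refl => exact h
  | tail hw hr ih =>
    obtain ⟨x, hx⟩ := hr
    exact hv.mem_of_isIsotropicReflexion hu₀ (mem_skeleton_of_mem_spine hu hw) hx₀ hx ih

/-! ### Counting anisotropic reflexions -/

/-- `v.Steps n u`: there is a chain of reflexions from `v` to `u` of which exactly `n` are
anisotropic. -/
inductive Steps (v : SuperRootDatum X 𝔥) : ℕ → SuperRootDatum X 𝔥 → Prop
  | refl : Steps v 0 v
  | isotropic {n : ℕ} {u u' : SuperRootDatum X 𝔥} {x : X} :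
      Steps v n u → u.IsIsotropicReflexion x u' → Steps v n u'
  | anisotropic {n : ℕ} {u u' : SuperRootDatum X 𝔥} {x : X} :
      Steps v n u → u.IsAnisotropicReflexion x u' → Steps v (n + 1) u'

theorem Steps.mem_skeleton {v u : SuperRootDatum X 𝔥} {n : ℕ} (h : v.Steps n u) :
    u ∈ v.skeleton := by
  induction h with
  | refl => exact .refl
  | isotropic _ h ih => exact .tail ih ⟨_, Or.inl h⟩
  | anisotropic _ h ih => exact .tail ih ⟨_, Or.inr h⟩

theorem exists_steps {v u : SuperRootDatum X 𝔥} (h : u ∈ v.skeleton) : ∃ n, v.Steps n u := by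
  induction h with
  | refl => exact ⟨0, .refl⟩
  | tail _ h ih =>
    obtain ⟨n, hn⟩ := ih
    obtain ⟨x, hx | hx⟩ := h
    exacts [⟨n, hn.isotropic hx⟩, ⟨n + 1, hn.anisotropic hx⟩]

theorem Steps.of_mem_spine {v u u' : SuperRootDatum X 𝔥} {n : ℕ} (h : v.Steps n u)
    (hs : u' ∈ u.spine) : v.Steps n u' := by
  induction hs with
  | refl => exact h
  | tail _ hr ih =>
    obtain ⟨x, hx⟩ := hr
    exact ih.isotropic hx

theorem Steps.mem_spine {v u : SuperRootDatum X 𝔥} (h : v.Steps 0 u) : u ∈ v.spine := by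
  generalize hn : 0 = n at h
  induction h with
  | refl => exact .refl
  | isotropic _ h ih => exact .tail (ih hn) ⟨_, h⟩
  | anisotropic => omega

/-- The last anisotropic reflexion of a chain, with the isotropic tail after it. -/
theorem Steps.exists_last {v u : SuperRootDatum X 𝔥} {n : ℕ} (h : v.Steps (n + 1) u) :
    ∃ w w' x, v.Steps n w ∧ w.IsAnisotropicReflexion x w' ∧ u ∈ w'.spine := by
  generalize hk : n + 1 = k at h
  induction h with
  | refl => omega
  | isotropic _ h ih =>
    obtain ⟨w, w', x, h₁, h₂, h₃⟩ := ih hk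
    exact ⟨w, w', x, h₁, h₂, h₃.tail ⟨_, h⟩⟩
  | anisotropic hs h _ =>
    obtain rfl := Nat.succ_injective hk
    exact ⟨_, _, _, hs, h, .refl⟩

/-- In an admissible component the reflection depends only on the root, up to sign. -/
theorem Admissible.rootReflection_eq {v u u' : SuperRootDatum X 𝔥} (hv : v.Admissible)
    (hu : u ∈ v.skeleton) (hu' : u' ∈ v.skeleton) {x y : X} (hx : u.cartan x x ≠ 0)
    (hy : u'.cartan y y ≠ 0) (h : u.b x = u'.b y ∨ u.b x = -u'.b y) :
    u.rootReflection x hx = u'.rootReflection y hy := by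
  obtain ⟨c, hc0, hc⟩ := hv.exists_a_eq_smul hu hu' h
  ext k
  rw [rootReflection_apply, rootReflection_apply]
  have hy' : u'.b y (u'.a y) ≠ 0 := hy
  congr 1
  rcases h with h | h
  · rw [cartan, cartan, hc, h, map_smul, smul_smul, smul_eq_mul]
    congr 1
    field_simp
  · rw [cartan, cartan, hc, h, LinearMap.neg_apply, LinearMap.neg_apply, map_smul, smul_smul,
      smul_eq_mul]
    congr 1
    field_simp

/-- Exchange property: reflecting `u` in an anisotropic real root which is positive at `u` and
negative at `v` shortens a chain from `v` to `u`. -/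
theorem Admissible.exists_steps_transport {v u₀ u : SuperRootDatum X 𝔥} (hv : v.Admissible)
    (hu₀ : u₀ ∈ v.skeleton) {x₀ : X} (hx₀ : u₀.cartan x₀ x₀ ≠ 0)
    (hneg : -u₀.b x₀ ∈ v.positiveCone) {n : ℕ} (h : v.Steps n u)
    (hpos : u₀.b x₀ ∈ u.positiveCone) :
    ∃ m < n, v.Steps m (u.transport (u₀.rootReflection x₀ hx₀)) := by
  induction h with
  | refl => exact absurd (v.eq_zero_of_neg_mem hpos hneg) (u₀.b_ne_zero x₀)
  | isotropic hs h ih =>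
    obtain ⟨m, hm, hst⟩ := ih (hv.mem_of_isIsotropicReflexion hu₀ (hs.isotropic h).mem_skeleton
      hx₀ h.symm hpos)
    exact ⟨m, hm, hst.isotropic (h.transport _)⟩
  | @anisotropic n u u' x hs h ih =>
    rcases hv.b_mem_or_neg_mem hu₀ hs.mem_skeleton x₀ with hpu | hnu
    · obtain ⟨m, hm, hst⟩ := ih hpu
      exact ⟨m + 1, by omega, hst.anisotropic (h.transport _)⟩
    · -- The sign of the root changes at this step, so the step is the reflection in it.
      have heq := hv.eq_b_of_mem_of_neg_mem hu₀ hs.mem_skeleton (Or.inr h) (Or.inr rfl) hnu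
        (by rwa [neg_neg])
      obtain ⟨-, hx, rfl⟩ := h
      refine ⟨n, by omega, ?_⟩
      rw [hv.rootReflection_eq hu₀ hs.mem_skeleton hx₀ hx (Or.inr (neg_eq_iff_eq_neg.mp heq)),
        anisotropicReflexion_eq_transport, transport_rootReflection_transport]
      exact hs

/-! ### Pairs of principal roots -/

/-- An integral combination of two distinct anisotropic simple roots of a spine which is an
anisotropic real root has coefficients of the same sign: mixed signs would make it negative where
one of the two is simple and positive where the other is. -/
theorem Admissible.not_mixed_sign {v u₀ u₁ u₂ : SuperRootDatum X 𝔥} (hv : v.Admissible)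
    (hu₀ : u₀ ∈ v.skeleton) {x₀ x₁ x₂ : X} (hx₀ : u₀.cartan x₀ x₀ ≠ 0)
    (hu₁ : u₁ ∈ v.skeleton) (hu₂ : u₂ ∈ u₁.spine) (hx₁ : u₁.cartan x₁ x₁ ≠ 0)
    (hx₂ : u₂.cartan x₂ x₂ ≠ 0) (hne : u₁.b x₁ ≠ u₂.b x₂) {c₁ c₂ : ℤ}
    (h : u₀.b x₀ = c₁ • u₁.b x₁ + c₂ • u₂.b x₂) : ¬ (0 < c₁ ∧ c₂ < 0) := by
  rintro ⟨hc₁, hc₂⟩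
  -- A root simple elsewhere on the spine has a positive coefficient away from a given simple root.
  have key : ∀ (w w' : SuperRootDatum X 𝔥) (x y : X), w ∈ v.skeleton → w' ∈ w.spine →
      w'.cartan y y ≠ 0 → w.b x ≠ w'.b y → ∃ z n, z ≠ x ∧ 0 < n ∧
        w.coord z (w'.b y) = (n : ℕ) := by
    intro w w' x y hw hw' hy hne
    have hw'' := mem_skeleton_of_mem_spine hw hw'
    have hpos : w'.b y ∈ w.positiveCone :=
      hv.mem_of_mem_spine hw'' hw'' hy (mem_spine_symm hw') (w'.b_mem_positiveCone y)
    by_contra! hcon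
    obtain ⟨n, hn⟩ := w.exists_eq_nsmul hpos (x := x) fun z hz => by
      obtain ⟨n, hn⟩ := w.exists_coord_eq_natCast hpos z
      rcases Nat.eq_zero_or_pos n with rfl | hn0
      · simpa using hn
      · exact absurd hn (hcon z n hz hn0)
    rw [hv.eq_one_of_nsmul_b hw'' hw (Or.inl hn.symm), one_smul] at hn
    exact hne hn.symm
  have hu₂' := mem_skeleton_of_mem_spine hu₁ hu₂
  have hneg : -u₀.b x₀ ∈ u₁.positiveCone := by
    refine (hv.b_mem_or_neg_mem hu₀ hu₁ x₀).resolve_left fun hpos => ?_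
    obtain ⟨z, n, hz, hn, hcz⟩ := key u₁ u₂ x₁ x₂ hu₁ hu₂ hx₂ hne
    obtain ⟨k, hk⟩ := u₁.exists_coord_eq_natCast hpos z
    rw [h, map_add, map_zsmul, map_zsmul, u₁.coord_b_of_ne hz.symm, hcz, smul_zero, zero_add,
      zsmul_eq_mul] at hk
    have : c₂ * n = k := by exact_mod_cast hk
    have := mul_neg_of_neg_of_pos hc₂ (Int.natCast_pos.mpr hn)
    omega
  have hpos : u₀.b x₀ ∈ u₂.positiveCone := by
    refine (hv.b_mem_or_neg_mem hu₀ hu₂' x₀).resolve_right fun hneg => ?_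
    obtain ⟨z, n, hz, hn, hcz⟩ := key u₂ u₁ x₂ x₁ hu₂' (mem_spine_symm hu₂) hx₁ hne.symm
    obtain ⟨k, hk⟩ := u₂.exists_coord_eq_natCast hneg z
    rw [h, map_neg, map_add, map_zsmul, map_zsmul, u₂.coord_b_of_ne hz.symm, hcz, smul_zero,
      add_zero, zsmul_eq_mul] at hk
    have : -(c₁ * n) = k := by exact_mod_cast hk
    have := mul_pos hc₁ (Int.natCast_pos.mpr hn)
    omega
  exact u₀.b_ne_zero x₀ (u₁.eq_zero_of_neg_mem
    (hv.mem_of_mem_spine hu₀ hu₂' hx₀ (mem_spine_symm hu₂) hpos) hneg)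

theorem b_mem_positiveAnisotropicRoots {v u : SuperRootDatum X 𝔥} (hu : u ∈ v.skeleton) {x : X}
    (hr : u.Reflectable x) (hx : u.cartan x x ≠ 0) (h : u.b x ∈ v.positiveCone) :
    u.b x ∈ v.positiveAnisotropicRoots :=
  ⟨⟨u, hu, x, hr, hx, rfl⟩, h⟩

theorem ne_zero_of_mem_positiveAnisotropicRoots {v : SuperRootDatum X 𝔥} {α : Module.Dual ℂ 𝔥}
    (h : α ∈ v.positiveAnisotropicRoots) : α ≠ 0 := by
  obtain ⟨⟨u, -, x, -, -, rfl⟩, -⟩ := h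
  exact u.b_ne_zero x

/-- Integral combinations of two positive anisotropic roots with coefficients of the same sign are
decomposable unless they are one of the two roots. -/
theorem eq_or_eq_of_indecomposable {v : SuperRootDatum X 𝔥} {α β γ : Module.Dual ℂ 𝔥}
    (hα : IsIndecomposableIn v.positiveAnisotropicRoots α)
    (hβ : β ∈ v.positiveAnisotropicRoots) (hγ : γ ∈ v.positiveAnisotropicRoots) {c d : ℤ}
    (h : α = c • β + d • γ) (h₁ : ¬ (0 < c ∧ d < 0)) (h₂ : ¬ (0 < d ∧ c < 0)) :
    α = β ∨ α = γ := by
  have hα0 := ne_zero_of_mem_positiveAnisotropicRoots hα.1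
  rcases le_or_gt 0 c with hc | hc
  · rcases le_or_gt 0 d with hd | hd
    · lift c to ℕ using hc
      lift d to ℕ using hd
      rw [natCast_zsmul, natCast_zsmul] at h
      by_cases hcd : 2 ≤ c + d
      · refine absurd ?_ (hα.2 (Multiset.replicate c β + Multiset.replicate d γ) (by simpa) ?_)
        · simp [h]
        · intro δ hδ
          rcases Multiset.mem_add.mp hδ with hδ | hδ
          · rw [Multiset.eq_of_mem_replicate hδ]; exact hβ
          · rw [Multiset.eq_of_mem_replicate hδ]; exact hγ
      · obtain ⟨rfl, rfl⟩ | ⟨rfl, rfl⟩ | ⟨rfl, rfl⟩ :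
            (c = 0 ∧ d = 0) ∨ (c = 1 ∧ d = 0) ∨ (c = 0 ∧ d = 1) := by omega
        · exact absurd (by simpa using h) hα0
        · exact Or.inl (by simpa using h)
        · exact Or.inr (by simpa using h)
    · obtain rfl : c = 0 := by omega
      refine absurd (v.eq_zero_of_neg_mem hα.1.2 ?_) hα0
      have : -α = (-d).toNat • γ := by
        rw [← natCast_zsmul, Int.toNat_of_nonneg (by omega), h]
        simp
      rw [this]
      exact nsmul_mem hγ.2 _
  · have hd : d ≤ 0 := by
      by_contra! hd
      exact h₂ ⟨hd, hc⟩
    refine absurd (v.eq_zero_of_neg_mem hα.1.2 ?_) hα0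
    have : -α = (-c).toNat • β + (-d).toNat • γ := by
      rw [← natCast_zsmul, ← natCast_zsmul, Int.toNat_of_nonneg (by omega),
        Int.toNat_of_nonneg (by omega), h]
      simp only [neg_smul]
      abel
    rw [this]
    exact add_mem (nsmul_mem hβ.2 _) (nsmul_mem hγ.2 _)

/-- At a reflectable anisotropic `x` the coroot of `b x` is integral on `Q⁺`. -/
theorem exists_int_of_mem_positiveCone {u : SuperRootDatum X 𝔥} {x : X} (hr : u.Reflectable x)
    (hx : u.cartan x x ≠ 0) {μ : Module.Dual ℂ 𝔥} (hμ : μ ∈ u.positiveCone) :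
    ∃ k : ℤ, 2 / u.cartan x x * μ (u.a x) = k := by
  induction hμ using AddSubmonoid.closure_induction with
  | mem μ h =>
    obtain ⟨y, rfl⟩ := h
    change ∃ k : ℤ, 2 / u.cartan x x * u.cartan x y = k
    by_cases hy : y = x
    · subst hy
      exact ⟨2, by simpa using div_mul_cancel₀ 2 hx⟩
    · rcases hr with h | h | h
      · exact absurd h.1 hx
      · obtain ⟨n, hn⟩ := h.2.2 y hy
        exact ⟨-n, by push_cast; rw [← hn]; ring⟩
      · obtain ⟨n, hn⟩ := h.2.2 y hy
        exact ⟨-(2 * n), by push_cast; linear_combination 2 * hn⟩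
  | zero => exact ⟨0, by simp⟩
  | add μ ν _ _ h₁ h₂ =>
    obtain ⟨k, hk⟩ := h₁
    obtain ⟨l, hl⟩ := h₂
    exact ⟨k + l, by push_cast; rw [← hk, ← hl, LinearMap.add_apply]; ring⟩

/-- Descent in rank two: an indecomposable positive anisotropic root which is an integral
combination of two anisotropic simple roots of a spine is simple at a vertex no further from `v`,
and strictly nearer to `v` if the second root is negative at `v`. -/
theorem Admissible.descent {v : SuperRootDatum X 𝔥} (hv : v.Admissible) {α : Module.Dual ℂ 𝔥}
    (hα : IsIndecomposableIn v.positiveAnisotropicRoots α) (n : ℕ) :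
    ∀ {u₁ u₂ : SuperRootDatum X 𝔥} {x₁ x₂ : X} {c₁ c₂ : ℤ}, v.Steps n u₁ → u₂ ∈ u₁.spine →
      u₁.Reflectable x₁ → u₁.cartan x₁ x₁ ≠ 0 → u₂.Reflectable x₂ → u₂.cartan x₂ x₂ ≠ 0 →
      u₁.b x₁ ≠ u₂.b x₂ → α = c₁ • u₁.b x₁ + c₂ • u₂.b x₂ →
      ∃ m ≤ n, (-u₂.b x₂ ∈ v.positiveCone → m < n) ∧
        ∃ u x, v.Steps m u ∧ u.Reflectable x ∧ u.cartan x x ≠ 0 ∧ α = u.b x := by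
  induction n using Nat.strong_induction_on with
  | _ n ih =>
  -- Reflecting the pair in its negative member brings it nearer to `v`.
  have reflect : ∀ {u₁ u₂ : SuperRootDatum X 𝔥} {x₁ x₂ : X} {c₁ c₂ : ℤ}, v.Steps n u₁ →
      u₂ ∈ u₁.spine → u₁.Reflectable x₁ → u₁.cartan x₁ x₁ ≠ 0 → u₂.Reflectable x₂ →
      u₂.cartan x₂ x₂ ≠ 0 → u₁.b x₁ ≠ u₂.b x₂ → α = c₁ • u₁.b x₁ + c₂ • u₂.b x₂ →
      -u₂.b x₂ ∈ v.positiveCone →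
      ∃ m < n, ∃ u x, v.Steps m u ∧ u.Reflectable x ∧ u.cartan x x ≠ 0 ∧ α = u.b x := by
    intro u₁ u₂ x₁ x₂ c₁ c₂ hs h₂ hr₁ hx₁ hr₂ hx₂ hne h hneg
    have hu₁ := hs.mem_skeleton
    have hu₂ := mem_skeleton_of_mem_spine hu₁ h₂
    obtain ⟨m, hm, hst⟩ := hv.exists_steps_transport hu₂ hx₂ hneg hs
      (hv.mem_of_mem_spine hu₂ hu₂ hx₂ (mem_spine_symm h₂) (u₂.b_mem_positiveCone x₂))
    obtain ⟨k, hk⟩ := exists_int_of_mem_positiveCone hr₂ hx₂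
      (hv.mem_of_mem_spine hu₁ hu₁ hx₁ h₂ (u₁.b_mem_positiveCone x₁))
    have hb₁ := u₂.transport_rootReflection_b x₂ hx₂ u₁ x₁
    have hb₂ := u₂.transport_rootReflection_b x₂ hx₂ u₂ x₂
    rw [hk] at hb₁
    have h2 : 2 / u₂.cartan x₂ x₂ * u₂.b x₂ (u₂.a x₂) = 2 := div_mul_cancel₀ 2 hx₂
    rw [h2] at hb₂
    obtain ⟨m', hm', -, hfin⟩ := ih m hm (c₁ := c₁) (c₂ := -(c₁ * k + c₂)) hst
      (transport_mem_spine h₂ (u₂.rootReflection x₂ hx₂))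
      (reflectable_transport_iff.mpr hr₁) (by rwa [cartan_transport])
      (reflectable_transport_iff.mpr hr₂) (by rwa [cartan_transport])
      (fun he => hne ((u₂.rootReflection x₂ hx₂).symm.dualMap.injective he))
      (by
        rw [hb₁, hb₂, h]
        simp only [← Int.cast_smul_eq_zsmul ℂ]
        push_cast
        module)
    exact ⟨m', by omega, hfin⟩
  intro u₁ u₂ x₁ x₂ c₁ c₂ hs h₂ hr₁ hx₁ hr₂ hx₂ hne h
  have hu₁ := hs.mem_skeleton
  have hu₂ := mem_skeleton_of_mem_spine hu₁ h₂
  have hs₂ := hs.of_mem_spine h₂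
  by_cases hneg₂ : -u₂.b x₂ ∈ v.positiveCone
  · obtain ⟨m, hm, hfin⟩ := reflect hs h₂ hr₁ hx₁ hr₂ hx₂ hne h hneg₂
    exact ⟨m, hm.le, fun _ => hm, hfin⟩
  by_cases hneg₁ : -u₁.b x₁ ∈ v.positiveCone
  · obtain ⟨m, hm, hfin⟩ := reflect hs₂ (mem_spine_symm h₂) hr₂ hx₂ hr₁ hx₁ hne.symm
      (by rw [h, add_comm]) hneg₁
    exact ⟨m, hm.le, fun _ => hm, hfin⟩
  refine ⟨n, le_rfl, fun h => absurd h hneg₂, ?_⟩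
  have hp₁ := (hv.b_mem_or_neg_mem hu₁ .refl x₁).resolve_right hneg₁
  have hp₂ := (hv.b_mem_or_neg_mem hu₂ .refl x₂).resolve_right hneg₂
  obtain ⟨⟨u₀, hu₀, x₀, -, hx₀, hα₀⟩, -⟩ := hα.1
  rcases eq_or_eq_of_indecomposable hα (b_mem_positiveAnisotropicRoots hu₁ hr₁ hx₁ hp₁)
    (b_mem_positiveAnisotropicRoots hu₂ hr₂ hx₂ hp₂) h
    (hv.not_mixed_sign hu₀ hx₀ hu₁ h₂ hx₁ hx₂ hne (hα₀ ▸ h))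
    (hv.not_mixed_sign hu₀ hx₀ hu₂ (mem_spine_symm h₂) hx₂ hx₁ hne.symm
      (hα₀ ▸ h.trans (add_comm _ _))) with he | he
  · exact ⟨u₁, x₁, hs, hr₁, hx₁, he⟩
  · exact ⟨u₂, x₂, hs₂, hr₂, hx₂, he⟩

/-- Induction on the number of anisotropic reflexions separating `v` from a vertex where `α` is
simple. The last of them reflects in a root `β`; if it leads away from `v`, then `β` and `α` form a
pair to which `descent` applies. -/
theorem Admissible.mem_principalRoots_of_indecomposable {v : SuperRootDatum X 𝔥}
    (hv : v.Admissible) {α : Module.Dual ℂ 𝔥}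
    (hα : IsIndecomposableIn v.positiveAnisotropicRoots α) : α ∈ v.principalRoots := by
  suffices ∀ n u x, v.Steps n u → u.Reflectable x → u.cartan x x ≠ 0 → α = u.b x →
      ∃ u ∈ v.spine, ∃ x, α = u.b x by
    obtain ⟨u, hu, x, hr, hx, h⟩ := hα.1.1
    obtain ⟨n, hn⟩ := exists_steps hu
    exact ⟨hα.1.1, this n u x hn hr hx h⟩
  intro n
  induction n using Nat.strong_induction_on with
  | _ n ih =>
  intro u x hs hr hx h
  cases n with
  | zero => exact ⟨u, hs.mem_spine, x, h⟩
  | succ n =>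
  obtain ⟨w, w', y, hw, hrefl, hsp⟩ := hs.exists_last
  have hw' := (hw.anisotropic hrefl).mem_skeleton
  obtain ⟨hry, hy, rfl⟩ := hrefl
  have hby : (w.anisotropicReflexion y hy).b y = -w.b y :=
    (IsReflexion.b_eq (Or.inr ⟨hry, hy, rfl⟩)).1
  have hry' : (w.anisotropicReflexion y hy).Reflectable y := by
    rwa [anisotropicReflexion_eq_transport, reflectable_transport_iff]
  have hy' : (w.anisotropicReflexion y hy).cartan y y ≠ 0 := by
    rwa [anisotropicReflexion_eq_transport, cartan_transport]
  by_cases hneg : -w.b y ∈ v.positiveCone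
  · -- The last anisotropic step moves towards `v`, so `u` can be reached by a shorter chain.
    obtain ⟨m, hm, hst⟩ := hv.exists_steps_transport hw.mem_skeleton hy hneg hw
      (w.b_mem_positiveCone y)
    rw [← anisotropicReflexion_eq_transport] at hst
    exact ih m (by omega) u x (hst.of_mem_spine hsp) hr hx h
  · have hpos := (hv.b_mem_or_neg_mem hw.mem_skeleton .refl y).resolve_right hneg
    have hne : u.b x ≠ (w.anisotropicReflexion y hy).b y := by
      intro he
      rw [hby] at he
      refine w.b_ne_zero y (v.eq_zero_of_neg_mem hpos ?_)
      rw [← he, ← h]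
      exact hα.1.2
    obtain ⟨m, -, hm, u', x', hst, hr', hx', h'⟩ := hv.descent hα (n + 1) (c₁ := 1) (c₂ := 0) hs
      (mem_spine_symm hsp) hr hx hry' hy' hne (by simpa using h)
    exact ih m (hm (by rwa [hby, neg_neg])) u' x' hst hr' hx' h'

/-! ### Principal roots are indecomposable -/

/-- Every nonzero element of `Q⁺` contributes at least one to the height of a sum. -/
theorem exists_height_sum_eq {u : SuperRootDatum X 𝔥} (s : Multiset (Module.Dual ℂ 𝔥))
    (hs : ∀ β ∈ s, β ∈ u.positiveCone ∧ β ≠ 0) :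
    ∃ n : ℕ, u.height s.sum = n ∧ Multiset.card s ≤ n := by
  induction s using Multiset.induction_on with
  | empty => exact ⟨0, by simp⟩
  | cons β s ih =>
    obtain ⟨n, hn, hle⟩ := ih fun γ hγ => hs γ (Multiset.mem_cons_of_mem hγ)
    obtain ⟨hβ, hβ0⟩ := hs β (Multiset.mem_cons_self β s)
    obtain ⟨m, hm⟩ := (u.eq_zero_or_height_eq hβ).resolve_left hβ0
    refine ⟨m + 1 + n, ?_, ?_⟩
    · rw [Multiset.sum_cons, map_add, hm, hn]
      push_cast
      ring
    · rw [Multiset.card_cons]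
      omega

theorem Admissible.indecomposable_of_mem_principalRoots {v : SuperRootDatum X 𝔥}
    (hv : v.Admissible) {α : Module.Dual ℂ 𝔥} (hα : α ∈ v.principalRoots) :
    IsIndecomposableIn v.positiveAnisotropicRoots α := by
  obtain ⟨hαan, u, hu, x, hαu⟩ := hα
  have hu' : u ∈ v.skeleton := mem_skeleton_of_mem_spine .refl hu
  refine ⟨⟨hαan, ?_⟩, fun s hs hmem hsum => ?_⟩
  · obtain ⟨u₀, hu₀, x₀, -, hx₀, rfl⟩ := hαan
    refine hv.mem_of_mem_spine hu₀ hu' hx₀ (mem_spine_symm hu) ?_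
    rw [hαu]
    exact u.b_mem_positiveCone x
  · -- All members of the family are positive at `u`, where `α` has height one.
    obtain ⟨n, hn, hle⟩ := exists_height_sum_eq (u := u) s fun β hβ => by
      refine ⟨?_, ne_zero_of_mem_positiveAnisotropicRoots (hmem β hβ)⟩
      obtain ⟨⟨u₀, hu₀, x₀, -, hx₀, rfl⟩, hpos⟩ := hmem β hβ
      exact hv.mem_of_mem_spine hu₀ .refl hx₀ hu hpos
    rw [hsum, hαu, height_b] at hn
    have : n = 1 := by exact_mod_cast hn.symm
    omega

end SuperRootDatum

theorem mainTheorem8 {X : Type w} [Finite X] {𝔥 : Type u} [AddCommGroup 𝔥] [Module ℂ 𝔥]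
    [FiniteDimensional ℂ 𝔥] (v : SuperRootDatum X 𝔥) (hv : v.Admissible) :
    v.principalRoots = {α | IsIndecomposableIn v.positiveAnisotropicRoots α} :=
  Set.ext fun _ => ⟨hv.indecomposable_of_mem_principalRoots,
    hv.mem_principalRoots_of_indecomposable⟩
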